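/- **Theorem 7.1.** For complex $q$ with $|q|<1$ put $$E(q)=\prod_{n\ge1}(1-q^n),\qquad \varphi(q)=\sum_{n=-\infty}^{\infty}q^{n^2},\qquad \psi(q)=\sum_{n=-\infty}^{\infty}q^{2n^2-n}.$$ Then, for all complex $q$ with $|q|<1$, $$\varphi(-q)\varphi^3(-q^5)=\frac15\left(\frac{E^5(q)}{E(q^5)}+4\frac{E^5(q^2)}{E(q^{10})}\right)-\left(q\frac{E^5(q^5)}{E(q)}-4q^2\frac{E^5(q^{10})}{E(q^2)}\right),$$ $$\varphi^3(-q)\varphi(-q^5)=\frac15\left(\frac{E^5(q)}{E(q^5)}+4\frac{E^5(q^2)}{E(q^{10})}\right)-5\left(q\frac{E^5(q^5)}{E(q)}-4q^2\frac{E^5(q^{10})}{E(q^2)}\right),$$ $$4q\psi^3(q)\psi(q^5)=\frac15\left(\frac{E^5(q)}{E(q^5)}-\frac{E^5(q^2)}{E(q^{10})}\right)+5\left(q\frac{E^5(q^5)}{E(q)}+q^2\frac{E^5(q^{10})}{E(q^2)}\right),$$ $$4q^2\psi(q)\psi^3(q^5)=\frac15\left(\frac{E^5(q)}{E(q^5)}-\frac{E^5(q^2)}{E(q^{10})}\right)+\left(q\frac{E^5(q^5)}{E(q)}+q^2\frac{E^5(q^{10})}{E(q^2)}\right).$$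 Furthermore, let $a(n),b(n),c(n),d(n)$ $(n\ge1)$ be defined by the power series expansions, for $|q|<1$, $$\varphi(q)\varphi^3(q^5)=1+\sum_{n\ge1}a(n)q^n,\qquad \varphi^3(q)\varphi(q^5)=1+\sum_{n\ge1}b(n)q^n,$$ $$4q\psi^3(q)\psi(q^5)=\sum_{n\ge1}c(n)q^n,\qquad 4q^2\psi(q)\psi^3(q^5)=\sum_{n\ge1}d(n)q^n.$$ These expansions exist, and their coefficients count representations: $a(n)$ and $b(n)$ are the numbers of $(x,y,z,w)\in\mathbb Z^4$ with $x^2+5(y^2+z^2+w^2)=n$ and with $5x^2+y^2+z^2+w^2=n$, respectively; $c(n)$ and $d(n)$ are $4$ times the numbers of quadruples $(x,y,z,w)$ of triangular numbers $0,1,3,6,\dots$ with $5x+y+z+w=n-1$ and with $x+5(y+z+w)=n-2$, respectively. For every $n\ge1$ with prime factorization $$n=2^g5^{h}\prod_{i=1}^r p_i^{v_i}\prod_{j=1}^s q_j^{w_j},\qquad p_i\equiv\pm1\!\!\pmod 5,\quad q_j\equiv\pm2\!\!\pmod 5,\ q_j\text{ odd},$$ let $t=w_1+\dots+w_s$ be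 the number of odd prime divisors of $n$, counted with multiplicity, that are congruent to $\pm2$ modulo $5$, and let $$\Pi(n)=\prod_{i=1}^r\frac{1-p_i^{v_i+1}}{1-p_i}\prod_{j=1}^s\frac{1-(-q_j)^{w_j+1}}{1+q_j}.$$ Then $$a(n)=(-1)^{n-1}\bigl(1+5^{h}(-1)^{g+t}\bigr)\frac{5+(-2)^{g+1}}{3}\,\Pi(n),$$ $$b(n)=(-1)^{n-1}\bigl(1+5^{h+1}(-1)^{g+t}\bigr)\frac{5+(-2)^{g+1}}{3}\,\Pi(n),$$ $$c(n)=(-2)^g\bigl(-1+5^{h+1}(-1)^{g+t}\bigr)\,\Pi(n),$$ $$d(n)=(-2)^g\bigl(-1+5^{h}(-1)^{g+t}\bigr)\,\Pi(n).$$ -/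

import Mathlib

noncomputable section

/-- The infinite `q`-shifted factorial `(a; q)_∞ = ∏_{n ≥ 0} (1 - a qⁿ)`. -/
def qPochhammerInf (a q : ℂ) : ℂ := ∏' n : ℕ, (1 - a * q ^ n)

/-- `E(q) = (q; q)_∞ = ∏_{n ≥ 1} (1 - qⁿ)`. -/
def eulerE (q : ℂ) : ℂ := qPochhammerInf q q

/-- Ramanujan's general theta function
`f(a, b) = ∑_{n ∈ ℤ} a ^ (n (n + 1) / 2) b ^ (n (n - 1) / 2)`, for `|a b| < 1`.
Both divisions are exact and both exponents are nonnegative. -/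
def ramanujanF (a b : ℂ) : ℂ :=
  ∑' n : ℤ, a ^ (n * (n + 1) / 2) * b ^ (n * (n - 1) / 2)

/-- `φ(q) = f(q, q) = ∑_{n ∈ ℤ} q ^ (n²)`. -/
def ramanujanPhi (q : ℂ) : ℂ := ramanujanF q q

/-- `ψ(q) = f(q, q³) = ∑_{n ∈ ℤ} q ^ (2 n² - n)`. -/
def ramanujanPsi (q : ℂ) : ℂ := ramanujanF q (q ^ 3)

/-- The number of `(x, y, z, w) ∈ ℤ⁴` with `k x² + l (y² + z² + w²) = n`. -/
def quaternaryCount (k l : ℤ) (n : ℕ) : ℕ :=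
  Set.ncard {v : ℤ × ℤ × ℤ × ℤ |
    k * v.1 ^ 2 + l * (v.2.1 ^ 2 + v.2.2.1 ^ 2 + v.2.2.2 ^ 2) = n}

/-- `m` is a triangular number `0, 1, 3, 6, 10, …`. -/
def IsTriangularNumber (m : ℕ) : Prop := ∃ k : ℕ, m = k * (k + 1) / 2

/-- The number of quadruples `(x, y, z, w)` of triangular numbers with
`k x + l (y + z + w) + s = n`, that is, `k x + l (y + z + w) = n - s`. -/
def triangularCount (k l s n : ℕ) : ℕ :=
  Set.ncard {v : ℕ × ℕ × ℕ × ℕ |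
    IsTriangularNumber v.1 ∧ IsTriangularNumber v.2.1 ∧
    IsTriangularNumber v.2.2.1 ∧ IsTriangularNumber v.2.2.2 ∧
    k * v.1 + l * (v.2.1 + v.2.2.1 + v.2.2.2) + s = n}

/-- The prime divisors `p` of `n` with `p ≡ ± 1 (mod 5)`. -/
def primesOne (n : ℕ) : Finset ℕ :=
  n.primeFactors.filter fun p => p % 5 = 1 ∨ p % 5 = 4

/-- The odd prime divisors `p` of `n` with `p ≡ ± 2 (mod 5)`. -/
def primesTwo (n : ℕ) : Finset ℕ :=
  n.primeFactors.filter fun p => p ≠ 2 ∧ (p % 5 = 2 ∨ p % 5 = 3)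

/-- The number of odd prime divisors of `n` that are `≡ ± 2 (mod 5)`,
counted with multiplicity. -/
def primesTwoOmega (n : ℕ) : ℕ := ∑ p ∈ primesTwo n, n.factorization p

/-- `∏_i (1 - p_i ^ (v_i + 1)) / (1 - p_i) · ∏_j (1 - (-q_j) ^ (w_j + 1)) / (1 + q_j)`,
where `n = 2 ^ g 5 ^ d ∏_i p_i ^ v_i ∏_j q_j ^ w_j` is the prime factorization, with
`p_i ≡ ± 1 (mod 5)` and `q_j` odd, `q_j ≡ ± 2 (mod 5)`. -/
def primesProd (n : ℕ) : ℂ :=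
  (∏ p ∈ primesOne n, (1 - (p : ℂ) ^ (n.factorization p + 1)) / (1 - (p : ℂ))) *
  ∏ p ∈ primesTwo n, (1 - (-(p : ℂ)) ^ (n.factorization p + 1)) / (1 + (p : ℂ))

end

section

open Filter Topology

/-! ### Infinite `q`-shifted factorials -/

/-! The Jacobi triple product (`theta_eq_prod`) turns `φ` and `ψ` into quotients of values of `E`.
The form `x² + y²` restricted to the index-five sublattice spanned by `(2, 1)` and `(-1, 2)` is `5
(m² + n²)`; splitting the double series for `φ²` and `ψ²` over its cosets yields
`eulerE_relation_phi` and `eulerE_relation_psi`. With `t = E(q²) E⁵(q⁵) / (q E(q) E⁵(q¹⁰))`, these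
say that `t - 4` and `t + 1` are eta quotients too. Every term of the four identities is then a
common factor times a rational function of `t`, and `theta_identities` is algebra.

The coefficients come from Lambert series for `q E⁵(q⁵) / E(q)` and `E⁵(q) / E(q⁵)`. Both are cases
of the Weierstrass formula `℘(u) - ℘(v) = -σ(u + v) σ(u - v) / (σ(u)² σ(v)²)`, here
`weierstrass_sub`. It is proved without elliptic function theory: splitting a double series by
parity shows that `y θ(xy) θ(x/y)` is a 2 × 2 determinant in two fixed series, and that `(Dθ)² - θ
D²θ` lies in the span of the same two series. The logarithm of the triple product identifies `((Dθ)²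
- θ D²θ) / θ²` with a Lambert series. Base `q⁵` at the points `q, q²` gives `∑ χ(n/d) d`; base `q`
at `ζ, ζ²`, with `ζ` a primitive fifth root of unity, gives `∑ χ(d) d`, where `χ` is the quadratic
character modulo `5`.

Both divisor sums are multiplicative. Combining each with its value at `n / 2` gives the closed
forms, and uniqueness of power series coefficients finishes the proof. The counting statements
follow by grouping products of theta series by exponent. -/

lemma summable_norm_mul_pow (a : ℂ) {q : ℂ} (hq : ‖q‖ < 1) :
    Summable fun n : ℕ => ‖-(a * q ^ n)‖ := by
  simp only [norm_neg, norm_mul, norm_pow]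
  exact (summable_geometric_of_lt_one (norm_nonneg _) hq).mul_left _

lemma multipliable_qPochhammerInf (a : ℂ) {q : ℂ} (hq : ‖q‖ < 1) :
    Multipliable fun n : ℕ => (1 - a * q ^ n) := by
  simpa [sub_eq_add_neg] using multipliable_one_add_of_summable (summable_norm_mul_pow a hq)

lemma hasProd_qPochhammerInf (a : ℂ) {q : ℂ} (hq : ‖q‖ < 1) :
    HasProd (fun n : ℕ => (1 - a * q ^ n)) (qPochhammerInf a q) :=
  (multipliable_qPochhammerInf a hq).hasProd

lemma qPochhammerInf_ne_zero {a q : ℂ} (hq : ‖q‖ < 1) (h : ∀ n : ℕ, a * q ^ n ≠ 1) :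
    qPochhammerInf a q ≠ 0 := by
  have := tprod_one_add_ne_zero_of_summable (f := fun n : ℕ => -(a * q ^ n))
    (fun n => by simpa [← sub_eq_add_neg, sub_eq_zero] using (h n).symm)
    (summable_norm_mul_pow a hq)
  simpa [qPochhammerInf, sub_eq_add_neg] using this

lemma qPochhammerInf_ne_zero_of_norm_lt {a q : ℂ} (hq : ‖q‖ < 1) (ha : ‖a‖ < 1) :
    qPochhammerInf a q ≠ 0 := by
  refine qPochhammerInf_ne_zero hq fun n h => ?_
  have h1 : ‖a * q ^ n‖ < 1 := by
    rw [norm_mul, norm_pow]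
    exact mul_lt_one_of_nonneg_of_lt_one_left (norm_nonneg _) ha
      (pow_le_one₀ (norm_nonneg _) hq.le)
  simp [h] at h1

lemma norm_pow_lt_one {q : ℂ} (hq : ‖q‖ < 1) {m : ℕ} (hm : m ≠ 0) : ‖q ^ m‖ < 1 := by
  rw [norm_pow]
  exact pow_lt_one₀ (norm_nonneg _) hq hm

lemma eulerE_ne_zero {q : ℂ} (hq : ‖q‖ < 1) : eulerE q ≠ 0 :=
  qPochhammerInf_ne_zero_of_norm_lt hq hq

lemma eulerE_zero : eulerE 0 = 1 := by
  simp [eulerE, qPochhammerInf]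

lemma qPochhammerInf_eq_mul (a : ℂ) {q : ℂ} (hq : ‖q‖ < 1) :
    qPochhammerInf a q = (1 - a) * qPochhammerInf (a * q) q := by
  have h : HasProd (fun n : ℕ => (1 - a * q ^ (n + 1))) (qPochhammerInf (a * q) q) :=
    (hasProd_qPochhammerInf (a * q) hq).congr_fun fun n => by ring
  have h2 := h.zero_mul (f := fun n : ℕ => 1 - a * q ^ n)
  simpa using (hasProd_qPochhammerInf a hq).unique h2

/-- Splitting the factors of an infinite `q`-shifted factorial into residue classes. -/
lemma qPochhammerInf_dissect (a : ℂ) {q : ℂ} (hq : ‖q‖ < 1) (m : ℕ) [NeZero m] :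
    qPochhammerInf a q = ∏ j : Fin m, qPochhammerInf (a * q ^ (j : ℕ)) (q ^ m) := by
  have hm : m ≠ 0 := NeZero.ne m
  have h := hasProd_qPochhammerInf a hq
  rw [← (((Equiv.prodComm _ _).trans (Nat.divModEquiv m).symm).hasProd_iff
    (f := fun n : ℕ => (1 - a * q ^ n)))] at h
  have h2 := h.prod_fiberwise (g := fun j : Fin m => qPochhammerInf (a * q ^ (j : ℕ)) (q ^ m))
    (fun j => by
      refine (hasProd_qPochhammerInf (a * q ^ (j : ℕ)) (norm_pow_lt_one hq hm)).congr_fun ?_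
      intro n
      simp [Nat.divModEquiv, pow_add, pow_mul]
      ring)
  exact h2.unique (hasProd_fintype _)

lemma qPochhammerInf_mul_neg (a : ℂ) {q : ℂ} (hq : ‖q‖ < 1) :
    qPochhammerInf a q * qPochhammerInf (-a) q = qPochhammerInf (a ^ 2) (q ^ 2) := by
  refine ((hasProd_qPochhammerInf a hq).mul (hasProd_qPochhammerInf (-a) hq)).unique ?_
  refine (hasProd_qPochhammerInf (a ^ 2) (norm_pow_lt_one hq two_ne_zero)).congr_fun ?_
  intro n
  ring

lemma qPochhammerInf_mul_roots {ζ : ℂ} (hζ : 1 + ζ + ζ ^ 2 + ζ ^ 3 + ζ ^ 4 = 0)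
    (a : ℂ) {q : ℂ} (hq : ‖q‖ < 1) :
    qPochhammerInf a q * (qPochhammerInf (ζ * a) q * qPochhammerInf (ζ ^ 2 * a) q *
      qPochhammerInf (ζ ^ 3 * a) q * qPochhammerInf (ζ ^ 4 * a) q) =
      qPochhammerInf (a ^ 5) (q ^ 5) := by
  refine ((hasProd_qPochhammerInf a hq).mul
    ((((hasProd_qPochhammerInf (ζ * a) hq).mul (hasProd_qPochhammerInf (ζ ^ 2 * a) hq)).mul
      (hasProd_qPochhammerInf (ζ ^ 3 * a) hq)).mul
      (hasProd_qPochhammerInf (ζ ^ 4 * a) hq))).unique ?_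
  refine (hasProd_qPochhammerInf (a ^ 5) (norm_pow_lt_one hq (by norm_num))).congr_fun ?_
  intro n
  have h5 : ζ ^ 5 = 1 := by linear_combination (ζ - 1) * hζ
  rw [← pow_mul, mul_comm 5 n, pow_mul, ← mul_pow]
  have : ∀ y : ℂ, (1 - y) * ((1 - ζ * y) * (1 - ζ ^ 2 * y) * (1 - ζ ^ 3 * y) * (1 - ζ ^ 4 * y))
      = 1 - y ^ 5 := by
    intro y
    grind
  rw [← this]
  ring

/-! ### The Jacobi triple product -/

/-- The triangular number `n (n - 1) / 2`, for an integer `n`. -/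
def tri (n : ℤ) : ℤ := n * (n - 1) / 2

lemma two_mul_tri (n : ℤ) : 2 * tri n = n * (n - 1) :=
  Int.mul_ediv_cancel' (Int.even_mul_pred_self n).two_dvd

lemma tri_zero : tri 0 = 0 := by decide

lemma tri_add_one (n : ℤ) : tri (n + 1) = tri n + n := by
  have h1 := two_mul_tri (n + 1)
  have h2 := two_mul_tri n
  linarith

lemma tri_sub_one (n : ℤ) : tri (n - 1) = tri n + (1 - n) := by
  have h1 := two_mul_tri (n - 1)
  have h2 := two_mul_tri n
  linarith

/-- The coefficients `(-1)ⁿ q^{n (n - 1) / 2}` of the theta function. -/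
noncomputable def thetaCoeff (q : ℂ) (n : ℤ) : ℂ := (-1) ^ n * q ^ tri n

/-- The theta function `∑_{n ∈ ℤ} (-1)ⁿ q^{n (n - 1) / 2} xⁿ`. -/
noncomputable def theta (x q : ℂ) : ℂ := ∑' n : ℤ, thetaCoeff q n * x ^ n

lemma summable_zpow_tri {ρ : ℝ} (h0 : 0 < ρ) (h1 : ρ < 1) (σ : ℝ) :
    Summable fun n : ℤ => ρ ^ tri n * Real.exp (n * σ) := by
  have hl : Real.log ρ < 0 := Real.log_neg h0 h1
  have hpi := Real.pi_pos
  have hT : 0 < -Real.log ρ / (2 * Real.pi) := by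
    apply div_pos (by linarith) (by linarith)
  -- The Gaussian parameter matches the leading term `n² log ρ / 2`. The linear parameter dominates
  -- both `n σ` and the linear part `-n log ρ / 2` of `tri n * log ρ`.
  have h := summable_pow_mul_jacobiTheta₂_term_bound
    ((|σ| - Real.log ρ / 2) / (2 * Real.pi)) hT 0
  refine Summable.of_nonneg_of_le (fun n => by positivity) (fun n => ?_) h
  have e1 : ρ ^ tri n = Real.exp (Real.log ρ * tri n) := by
    rw [← Real.rpow_intCast, Real.rpow_def_of_pos h0]
  rw [e1, ← Real.exp_add, pow_zero, one_mul, Real.exp_le_exp]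
  have h2 : (2 : ℝ) * tri n = n * (n - 1) := by exact_mod_cast two_mul_tri n
  have h3 : -Real.pi * (-Real.log ρ / (2 * Real.pi) * (n : ℝ) ^ 2 -
      2 * ((|σ| - Real.log ρ / 2) / (2 * Real.pi)) * ((|n| : ℤ) : ℝ)) =
      Real.log ρ * n ^ 2 / 2 + (|σ| - Real.log ρ / 2) * |(n : ℝ)| := by
    rw [Int.cast_abs]
    field_simp
    ring
  rw [h3]
  have h4 : (n : ℝ) * σ ≤ |σ| * |(n : ℝ)| := by
    rw [← abs_mul, mul_comm]; exact le_abs_self _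
  have h5 : (tri n : ℝ) = (n ^ 2 - n) / 2 := by linarith
  have h6 : Real.log ρ * (-(n : ℝ)) ≤ -Real.log ρ * |(n : ℝ)| := by
    have := le_abs_self (n : ℝ)
    nlinarith
  rw [h5]
  nlinarith

lemma norm_thetaCoeff (q : ℂ) (n : ℤ) : ‖thetaCoeff q n‖ = ‖q‖ ^ tri n := by
  simp [thetaCoeff, norm_zpow]

lemma norm_zpow_eq_exp {x : ℂ} (hx : x ≠ 0) (n : ℤ) :
    ‖x‖ ^ n = Real.exp (n * Real.log ‖x‖) := by
  rw [← Real.rpow_intCast, Real.rpow_def_of_pos (norm_pos_iff.mpr hx), mul_comm]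

lemma summable_norm_theta {q x : ℂ} (h0 : q ≠ 0) (h1 : ‖q‖ < 1) (hx : x ≠ 0) :
    Summable fun n : ℤ => ‖thetaCoeff q n * x ^ n‖ := by
  refine (summable_zpow_tri (norm_pos_iff.mpr h0) h1 (Real.log ‖x‖)).congr fun n => ?_
  rw [norm_mul, norm_thetaCoeff, norm_zpow, norm_zpow_eq_exp hx]

/-- The finite `q`-shifted factorial `(q; q)_N`. -/
noncomputable def qFactorial (q : ℂ) (N : ℕ) : ℂ := ∏ i ∈ Finset.range N, (1 - q * q ^ i)

/-- The reciprocal of `(q; q)_m`, extended by zero to negative integers `m`. -/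
noncomputable def qFactorialRecip (q : ℂ) (m : ℤ) : ℂ := if m < 0 then 0 else (qFactorial q m.toNat)⁻¹

lemma one_sub_mul_pow_ne_zero {q : ℂ} (h1 : ‖q‖ < 1) (i : ℕ) : 1 - q * q ^ i ≠ 0 := by
  intro h
  have h2 : ‖q ^ (i + 1)‖ < 1 := norm_pow_lt_one h1 (Nat.succ_ne_zero i)
  rw [pow_succ', ← sub_eq_zero.mp h] at h2
  simp at h2

/-- Extension by zero makes the recursion hold for every integer: at `m = 0` the factor `1 - q ^ 0`
vanishes. The finite triple product can thus be summed over all of `ℤ` with no boundary terms. -/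
lemma qFactorialRecip_sub_one {q : ℂ} (h1 : ‖q‖ < 1) (m : ℤ) :
    qFactorialRecip q (m - 1) = (1 - q ^ m) * qFactorialRecip q m := by
  unfold qFactorialRecip
  rcases lt_trichotomy m 0 with h | h | h
  · rw [if_pos (by omega), if_pos h, mul_zero]
  · subst h
    simp
  · obtain ⟨k, rfl⟩ : ∃ k : ℕ, m = k + 1 := ⟨(m - 1).toNat, by omega⟩
    rw [if_neg (by omega), if_neg (by omega)]
    have e1 : ((k : ℤ) + 1 - 1).toNat = k := by omega
    have e2 : ((k : ℤ) + 1).toNat = k + 1 := by omega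
    rw [e1, e2, qFactorial, qFactorial, Finset.prod_range_succ, mul_inv]
    have e3 : q ^ ((k : ℤ) + 1) = q * q ^ k := by
      rw [← pow_succ']; exact_mod_cast rfl
    have := one_sub_mul_pow_ne_zero h1 k
    rw [e3]
    field_simp

/-- The finite form of the Jacobi triple product. -/
lemma hasSum_finite_triple_product {q x : ℂ} (h0 : q ≠ 0) (h1 : ‖q‖ < 1) (hx : x ≠ 0) (N : ℕ) :
    HasSum (fun n : ℤ => qFactorial q (2 * N) * (thetaCoeff q n * x ^ n) *
        (qFactorialRecip q (N - n) * qFactorialRecip q (N + n)))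
      (∏ i ∈ Finset.range N, (1 - x * q ^ i) * (1 - q / x * q ^ i)) := by
  induction N with
  | zero =>
    have := hasSum_single (f := fun n : ℤ => qFactorial q (2 * 0) * (thetaCoeff q n * x ^ n) *
        (qFactorialRecip q ((0 : ℕ) - n) * qFactorialRecip q ((0 : ℕ) + n))) 0 (by
      intro n hn
      rcases lt_or_gt_of_ne hn with h | h
      · simp [qFactorialRecip, h]
      · simp [qFactorialRecip, h])
    simpa [qFactorialRecip, qFactorial, thetaCoeff, tri_zero] using this
  | succ N ih =>
    rw [Finset.prod_range_succ]
    -- The new factor is `1 + q q^{2N} - q^N x - q^{N+1} / x`. The terms in `x` and `1 / x` are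
    -- paired with index shifts so that powers of `x` agree, and the claim becomes a recursion
    -- between coefficients.
    have ha := ih.mul_left (1 + q * (q ^ N) ^ 2)
    have hb := (((Equiv.subRight (1 : ℤ)).hasSum_iff).mpr ih).mul_left (q ^ N * x)
    have hc := (((Equiv.addRight (1 : ℤ)).hasSum_iff).mpr ih).mul_left (q ^ N * q / x)
    have := (ha.sub hb).sub hc
    have hval : (∏ i ∈ Finset.range N, (1 - x * q ^ i) * (1 - q / x * q ^ i)) *
        ((1 - x * q ^ N) * (1 - q / x * q ^ N)) =
        (1 + q * (q ^ N) ^ 2) * (∏ i ∈ Finset.range N, (1 - x * q ^ i) * (1 - q / x * q ^ i)) -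
        q ^ N * x * (∏ i ∈ Finset.range N, (1 - x * q ^ i) * (1 - q / x * q ^ i)) -
        q ^ N * q / x * ∏ i ∈ Finset.range N, (1 - x * q ^ i) * (1 - q / x * q ^ i) := by
      generalize ∏ i ∈ Finset.range N, (1 - x * q ^ i) * (1 - q / x * q ^ i) = P
      field_simp
      ring
    rw [hval]
    refine this.congr_fun fun n => ?_
    simp only [Function.comp_apply, Equiv.subRight_apply, Equiv.coe_addRight]
    have r1 : qFactorialRecip q (N - n) = (1 - q ^ N * q / q ^ n) *
        qFactorialRecip q ((N + 1 : ℕ) - n) := by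
      rw [show (N : ℤ) - n = ((N + 1 : ℕ) - n) - 1 by push_cast; ring,
        qFactorialRecip_sub_one h1, zpow_sub₀ h0, zpow_natCast, pow_succ]
    have r2 : qFactorialRecip q (N + n) = (1 - q ^ N * q * q ^ n) *
        qFactorialRecip q ((N + 1 : ℕ) + n) := by
      rw [show (N : ℤ) + n = ((N + 1 : ℕ) + n) - 1 by push_cast; ring,
        qFactorialRecip_sub_one h1, zpow_add₀ h0, zpow_natCast, pow_succ]
    have r3 : qFactorialRecip q (N - (n + 1)) = (1 - q ^ N / q ^ n) *
        qFactorialRecip q (N - n) := by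
      rw [show (N : ℤ) - (n + 1) = (N - n) - 1 by ring,
        qFactorialRecip_sub_one h1, zpow_sub₀ h0, zpow_natCast]
    have r4 : qFactorialRecip q (N + (n - 1)) = (1 - q ^ N * q ^ n) *
        qFactorialRecip q (N + n) := by
      rw [show (N : ℤ) + (n - 1) = (N + n) - 1 by ring,
        qFactorialRecip_sub_one h1, zpow_add₀ h0, zpow_natCast]
    have r5 : (N : ℤ) - (n - 1) = (N + 1 : ℕ) - n := by push_cast; ring
    have r6 : (N : ℤ) + (n + 1) = (N + 1 : ℕ) + n := by push_cast; ring
    have t1 : thetaCoeff q (n - 1) * x ^ (n - 1) =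
        -(thetaCoeff q n * x ^ n) * (q / q ^ n / x) := by
      rw [thetaCoeff, thetaCoeff, tri_sub_one, zpow_add₀ h0, zpow_sub₀ h0, zpow_sub₀ hx,
        zpow_sub₀ (by norm_num : (-1 : ℂ) ≠ 0)]
      simp
      ring
    have t2 : thetaCoeff q (n + 1) * x ^ (n + 1) =
        -(thetaCoeff q n * x ^ n) * (q ^ n * x) := by
      rw [thetaCoeff, thetaCoeff, tri_add_one, zpow_add₀ h0, zpow_add₀ hx,
        zpow_add₀ (by norm_num : (-1 : ℂ) ≠ 0)]
      simp
      ring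
    have f1 : qFactorial q (2 * (N + 1)) = qFactorial q (2 * N) *
        ((1 - q * (q ^ N) ^ 2) * (1 - q ^ 2 * (q ^ N) ^ 2)) := by
      rw [show 2 * (N + 1) = 2 * N + 1 + 1 by ring, qFactorial, qFactorial,
        Finset.prod_range_succ, Finset.prod_range_succ]
      ring
    rw [t1, t2, r3, r4, r5, r6, r1, r2, f1]
    have hn : q ^ n ≠ 0 := zpow_ne_zero n h0
    generalize qFactorialRecip q ((N + 1 : ℕ) - n) = A
    generalize qFactorialRecip q ((N + 1 : ℕ) + n) = B
    generalize thetaCoeff q n * x ^ n = X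
    generalize qFactorial q (2 * N) = Y
    generalize q ^ n = y at hn
    generalize q ^ N = Q
    field_simp
    ring

lemma tendsto_qFactorial {q : ℂ} (h1 : ‖q‖ < 1) :
    Tendsto (qFactorial q) atTop (𝓝 (eulerE q)) :=
  (hasProd_qPochhammerInf q h1).tendsto_prod_nat

lemma exists_norm_le_of_tendsto {u : ℕ → ℂ} {l : ℂ} (h : Tendsto u atTop (𝓝 l)) :
    ∃ C : ℝ, ∀ n, ‖u n‖ ≤ C := by
  obtain ⟨C, hC⟩ := h.norm.bddAbove_range
  exact ⟨C, fun n => hC ⟨n, rfl⟩⟩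

/-- The **Jacobi triple product**. -/
theorem theta_eq_prod {q x : ℂ} (h0 : q ≠ 0) (h1 : ‖q‖ < 1) (hx : x ≠ 0) :
    theta x q = eulerE q * (qPochhammerInf x q * qPochhammerInf (q / x) q) := by
  have hE := eulerE_ne_zero h1
  have hinv : Tendsto (fun n => (qFactorial q n)⁻¹) atTop (𝓝 (eulerE q)⁻¹) :=
    (tendsto_qFactorial h1).inv₀ hE
  obtain ⟨C, hC⟩ := exists_norm_le_of_tendsto (tendsto_qFactorial h1)
  obtain ⟨D, hD⟩ := exists_norm_le_of_tendsto hinv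
  have hC0 : 0 ≤ C := (norm_nonneg _).trans (hC 0)
  have hD0 : 0 ≤ D := (norm_nonneg _).trans (hD 0)
  have hD' : ∀ m, ‖qFactorialRecip q m‖ ≤ D := by
    intro m
    unfold qFactorialRecip
    split_ifs
    · simpa using hD0
    · exact hD _
  have hrec : ∀ n : ℤ, Tendsto (fun N : ℕ => qFactorialRecip q (N + n)) atTop
      (𝓝 (eulerE q)⁻¹) := by
    intro n
    have ht : Tendsto (fun N : ℕ => ((N : ℤ) + n).toNat) atTop atTop :=
      tendsto_atTop.mpr fun b => by
        filter_upwards [eventually_ge_atTop (b + n.natAbs)] with N hN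
        omega
    refine (hinv.comp ht).congr' ?_
    filter_upwards [eventually_ge_atTop n.natAbs] with N hN
    simp only [Function.comp_apply, qFactorialRecip]
    rw [if_neg (by omega)]
  have key := tendsto_tsum_of_dominated_convergence (𝓕 := atTop)
    (f := fun (N : ℕ) (n : ℤ) => qFactorial q (2 * N) * (thetaCoeff q n * x ^ n) *
        (qFactorialRecip q (N - n) * qFactorialRecip q (N + n)))
    (g := fun n : ℤ => eulerE q * (thetaCoeff q n * x ^ n) * ((eulerE q)⁻¹ * (eulerE q)⁻¹))
    (bound := fun n => C * D * D * ‖thetaCoeff q n * x ^ n‖)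
    ((summable_norm_theta h0 h1 hx).mul_left _)
    (fun n => by
      refine Tendsto.mul (Tendsto.mul ?_ tendsto_const_nhds) (Tendsto.mul ?_ (hrec n))
      · exact (tendsto_qFactorial h1).comp (tendsto_id.const_mul_atTop' two_pos)
      · simpa [sub_eq_add_neg] using hrec (-n))
    (Eventually.of_forall fun N n => by
      rw [norm_mul, norm_mul, norm_mul (qFactorialRecip q _)]
      calc _ ≤ C * ‖thetaCoeff q n * x ^ n‖ * (D * D) := by
            gcongr
            · exact hC _
            · exact hD' _
            · exact hD' _
        _ = _ := by ring)
  simp only [(hasSum_finite_triple_product h0 h1 hx _).tsum_eq] at key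
  have hp := ((hasProd_qPochhammerInf x h1).mul
    (hasProd_qPochhammerInf (q / x) h1)).tendsto_prod_nat
  have := tendsto_nhds_unique key hp
  rw [tsum_mul_right, tsum_mul_left] at this
  rw [← this, theta]
  field_simp

/-! ### Theta functions in powers of `q` -/

/-- The series `∑_{n ∈ ℤ} q^{A n (n - 1) / 2 + c n}`. -/
noncomputable def thetaPow (q : ℂ) (A : ℕ) (c : ℤ) : ℂ := ∑' n : ℤ, q ^ (A * tri n + c * n)

lemma zpow_tri_eq {q : ℂ} (h0 : q ≠ 0) (A : ℕ) (c n : ℤ) :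
    q ^ (A * tri n + c * n) = thetaCoeff (q ^ A) n * (-q ^ c) ^ n := by
  rw [thetaCoeff, zpow_add₀ h0, zpow_mul, zpow_mul, zpow_natCast, neg_eq_neg_one_mul (q ^ c),
    mul_zpow]
  have : ((-1 : ℂ) ^ n) * (-1) ^ n = 1 := by
    rw [← mul_zpow]; simp
  linear_combination (-(q ^ A) ^ tri n * (q ^ c) ^ n) * this

lemma thetaPow_eq_theta {q : ℂ} (h0 : q ≠ 0) (A : ℕ) (c : ℤ) :
    thetaPow q A c = theta (-q ^ c) (q ^ A) :=
  tsum_congr fun n => zpow_tri_eq h0 A c n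

lemma summable_norm_thetaPow {q : ℂ} (h0 : q ≠ 0) (h1 : ‖q‖ < 1) {A : ℕ} (hA : A ≠ 0) (c : ℤ) :
    Summable fun n : ℤ => ‖q ^ (A * tri n + c * n)‖ :=
  (summable_norm_theta (pow_ne_zero A h0) (norm_pow_lt_one h1 hA)
    (neg_ne_zero.mpr (zpow_ne_zero c h0))).congr fun n => by rw [zpow_tri_eq h0]

lemma thetaPow_eq_prod {q : ℂ} (h0 : q ≠ 0) (h1 : ‖q‖ < 1) {A : ℕ} (hA : A ≠ 0) (c : ℤ) :
    thetaPow q A c = eulerE (q ^ A) *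
      (qPochhammerInf (-q ^ c) (q ^ A) * qPochhammerInf (-q ^ (A - c)) (q ^ A)) := by
  rw [thetaPow_eq_theta h0, theta_eq_prod (pow_ne_zero A h0) (norm_pow_lt_one h1 hA)
    (neg_ne_zero.mpr (zpow_ne_zero c h0)), zpow_sub₀ h0, zpow_natCast, div_neg]

lemma thetaPow_add {q : ℂ} (h0 : q ≠ 0) (A : ℕ) (c : ℤ) :
    thetaPow q A c = q ^ c * thetaPow q A (A + c) := by
  rw [thetaPow, ← (Equiv.addRight (1 : ℤ)).tsum_eq, thetaPow, ← tsum_mul_left]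
  refine tsum_congr fun n => ?_
  rw [← zpow_add₀ h0, Equiv.coe_addRight, tri_add_one]
  ring_nf

lemma thetaPow_neg {q : ℂ} (h0 : q ≠ 0) (A : ℕ) (c : ℤ) :
    thetaPow q A c = q ^ c * thetaPow q A (-c) := by
  rw [thetaPow, ← (Equiv.subLeft (1 : ℤ)).tsum_eq, thetaPow, ← tsum_mul_left]
  refine tsum_congr fun n => ?_
  have : tri (1 - n) = tri n := by
    have h1 := two_mul_tri (1 - n)
    have h2 := two_mul_tri n
    linarith
  rw [← zpow_add₀ h0, Equiv.subLeft_apply, this]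
  ring_nf

/-- Quasi-periodicity combined with the reflection `n ↦ 1 - n`. Together they reduce the linear
parameters produced by the coset splitting to a few standard ones. -/
lemma thetaPow_reflect {q : ℂ} (h0 : q ≠ 0) (A : ℕ) (c : ℤ) :
    thetaPow q A (A - c) = thetaPow q A c := by
  rw [thetaPow_neg h0 A c, thetaPow_add h0 A (-c), ← mul_assoc, ← zpow_add₀ h0, sub_eq_add_neg]
  simp

lemma thetaPow_pow (q : ℂ) (k A : ℕ) (c : ℤ) :
    thetaPow (q ^ k) A c = thetaPow q (k * A) (k * c) := by
  refine tsum_congr fun n => ?_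
  rw [← zpow_natCast q k, ← zpow_mul]
  push_cast
  ring_nf

lemma ramanujanPhi_eq_thetaPow {q : ℂ} (h0 : q ≠ 0) : ramanujanPhi q = thetaPow q 2 1 := by
  refine tsum_congr fun n => ?_
  have h : n * (n + 1) / 2 = tri n + n := by
    rw [← tri_add_one, tri]; ring_nf
  rw [← zpow_add₀ h0, h, ← tri]
  push_cast
  ring_nf

lemma ramanujanPsi_eq_thetaPow {q : ℂ} (h0 : q ≠ 0) : ramanujanPsi q = thetaPow q 4 1 := by
  refine tsum_congr fun n => ?_
  have h : n * (n + 1) / 2 = tri n + n := by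
    rw [← tri_add_one, tri]; ring_nf
  rw [← zpow_natCast, ← zpow_mul, ← zpow_add₀ h0, h, ← tri]
  push_cast
  ring_nf

/-- The five cosets of the sublattice spanned by `(2, 1)` and `(-1, 2)`. -/
def latticeEquiv (s : ℤ) : Fin 5 × (ℤ × ℤ) ≃ ℤ × ℤ where
  toFun p := (2 * p.2.1 - p.2.2 + (p.1 : ℕ), p.2.1 + 2 * p.2.2 + s)
  invFun v :=
    let j := (v.1 - 2 * (v.2 - s)) % 5
    (⟨j.toNat, by omega⟩, ((2 * (v.1 - j) + (v.2 - s)) / 5, (2 * (v.2 - s) - (v.1 - j)) / 5))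
  left_inv := by
    rintro ⟨⟨j, hj⟩, m, n⟩
    simp only [Prod.mk.injEq, Fin.mk.injEq]
    refine ⟨?_, ?_, ?_⟩ <;> omega
  right_inv := by
    rintro ⟨x, y⟩
    simp only [Prod.mk.injEq]
    constructor <;> omega

lemma tsum_lattice {F : ℤ × ℤ → ℂ} (hF : Summable F) (s : ℤ) :
    ∑' v, F v = ∑ j : Fin 5, ∑' v : ℤ × ℤ, F (2 * v.1 - v.2 + (j : ℕ), v.1 + 2 * v.2 + s) := by
  have hs := (latticeEquiv s).summable_iff.mpr hF
  rw [← (latticeEquiv s).tsum_eq, ← tsum_fintype (L := .unconditional _)]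
  exact hs.tsum_prod

/-- Since `(2m - n)² + (m + 2n)² = 5 (m² + n²)` has no cross term, the exponent separates in `m` and
`n` on each coset, as `h` records. The offset `s` is left free to choose convenient coset
representatives. -/
lemma thetaPow_sq_eq_sum {q : ℂ} (h0 : q ≠ 0) (h1 : ‖q‖ < 1) {A A' : ℕ} (hA : A ≠ 0)
    (hA' : A' ≠ 0) (c s : ℤ) (e b b' : Fin 5 → ℤ)
    (h : ∀ (j : Fin 5) (m n : ℤ),
      (A * tri (2 * m - n + (j : ℕ)) + c * (2 * m - n + (j : ℕ))) +
        (A * tri (m + 2 * n + s) + c * (m + 2 * n + s)) =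
      e j + ((A' * tri m + b j * m) + (A' * tri n + b' j * n))) :
    thetaPow q A c ^ 2 = ∑ j, q ^ e j * (thetaPow q A' (b j) * thetaPow q A' (b' j)) := by
  have hs := summable_norm_thetaPow h0 h1 hA c
  have hF := summable_mul_of_summable_norm hs hs
  rw [sq, thetaPow, tsum_mul_tsum_of_summable_norm hs hs, tsum_lattice hF s]
  refine Finset.sum_congr rfl fun j _ => ?_
  rw [thetaPow, thetaPow, tsum_mul_tsum_of_summable_norm (summable_norm_thetaPow h0 h1 hA' _)
    (summable_norm_thetaPow h0 h1 hA' _), ← tsum_mul_left]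
  refine tsum_congr fun v => ?_
  rw [← zpow_add₀ h0, ← zpow_add₀ h0, ← zpow_add₀ h0, h]

/-- `φ²(q) - φ²(q⁵) = 4 q f(q, q⁹) f(q³, q⁷)`. -/
lemma thetaPow_two_one_sq {q : ℂ} (h0 : q ≠ 0) (h1 : ‖q‖ < 1) :
    thetaPow q 2 1 ^ 2 = thetaPow q 10 5 ^ 2 + 4 * q * (thetaPow q 10 9 * thetaPow q 10 7) := by
  rw [thetaPow_sq_eq_sum h0 h1 (A := 2) (A' := 10) (by norm_num) (by norm_num) 1 0
    (fun j => (j : ℕ) ^ 2) (fun j => 5 + 4 * (j : ℕ)) (fun j => 5 - 2 * (j : ℕ))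
    (fun j m n => by
      have e1 := two_mul_tri (2 * m - n + (j : ℕ))
      have e2 := two_mul_tri (m + 2 * n + 0)
      have e3 := two_mul_tri m
      have e4 := two_mul_tri n
      push_cast
      linear_combination e1 + e2 - 5 * e3 - 5 * e4)]
  -- The coset `j = 0` gives the square at `q⁵`. The shifts and reflections below bring the other
  -- four to one and the same product.
  simp only [Fin.sum_univ_five]
  have r3 := thetaPow_reflect h0 10 7
  have r1 := thetaPow_reflect h0 10 9
  have s1 := thetaPow_add h0 10 1
  have s11 := thetaPow_add h0 10 11
  have s3 := thetaPow_add h0 10 3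
  have s7 := thetaPow_add h0 10 7
  have n1 := thetaPow_neg h0 10 1
  have n3 := thetaPow_neg h0 10 3
  simp only [Fin.coe_ofNat_eq_mod]
  norm_num at *
  have t13 : q ^ 3 * thetaPow q 10 13 = thetaPow q 10 7 := by rw [← s3, r3]
  have t17 : q ^ 7 * thetaPow q 10 17 = thetaPow q 10 7 := s7.symm
  have t1 : q * thetaPow q 10 (-1) = thetaPow q 10 9 := by rw [← n1, r1]
  have t21 : q ^ 12 * thetaPow q 10 21 = thetaPow q 10 9 := by
    rw [← r1, s1, s11]; ring
  have t3 : q ^ 3 * thetaPow q 10 (-3) = thetaPow q 10 7 := by rw [← n3, r3]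
  linear_combination q * thetaPow q 10 9 * r3 + q * thetaPow q 10 1 * t13 +
    q * thetaPow q 10 7 * r1 + q * (q * thetaPow q 10 (-1)) * t17 + q * thetaPow q 10 7 * t1 +
    q * (q ^ 3 * thetaPow q 10 (-3)) * t21 + q * thetaPow q 10 9 * t3

/-- `ψ²(q) - q ψ²(q⁵) = f(q, q⁴) f(q², q³)`, up to a factor of `4`. -/
lemma thetaPow_one_one_sq {q : ℂ} (h0 : q ≠ 0) (h1 : ‖q‖ < 1) :
    thetaPow q 1 1 ^ 2 = q * thetaPow q 5 5 ^ 2 + 4 * (thetaPow q 5 4 * thetaPow q 5 3) := by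
  -- The exponents are centred at `-1/2`, and `(2, 1), (-1, 2)` send `(1/2, 1/2)` to `(1/2, 3/2)`.
  -- The offset `s = 1` therefore makes `j = 0` the coset that reproduces the square at `q⁵`.
  rw [thetaPow_sq_eq_sum h0 h1 (A := 1) (A' := 5) (by norm_num) (by norm_num) 1 1
    (fun j => 1 + tri ((j : ℕ) + 1)) (fun j => 5 + 2 * (j : ℕ)) (fun j => 5 - (j : ℕ))
    (fun j m n => by
      have e1 := two_mul_tri (2 * m - n + (j : ℕ))
      have e2 := two_mul_tri (m + 2 * n + 1)
      have e3 := two_mul_tri m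
      have e4 := two_mul_tri n
      have e5 := two_mul_tri ((j : ℕ) + 1)
      push_cast
      linarith)]
  simp only [Fin.sum_univ_five]
  have r3 := thetaPow_reflect h0 5 3
  have r4 := thetaPow_reflect h0 5 4
  have s1 := thetaPow_add h0 5 1
  have s2 := thetaPow_add h0 5 2
  have s3 := thetaPow_add h0 5 3
  have s4 := thetaPow_add h0 5 4
  have s6 := thetaPow_add h0 5 6
  have s8 := thetaPow_add h0 5 8
  simp only [Fin.coe_ofNat_eq_mod, tri]
  norm_num at *
  have t7 : q ^ 2 * thetaPow q 5 7 = thetaPow q 5 3 := by rw [← s2, r3]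
  have t11 : q ^ 7 * thetaPow q 5 11 = thetaPow q 5 4 := by
    rw [← r4, s1, s6]; ring
  have t13 : q ^ 11 * thetaPow q 5 13 = thetaPow q 5 3 := by
    rw [s3, s8]; ring
  linear_combination thetaPow q 5 4 * t7 - thetaPow q 5 3 * s4 + thetaPow q 5 2 * t11 +
    thetaPow q 5 4 * r3 + thetaPow q 5 1 * t13 + thetaPow q 5 3 * r4

/-! ### Product formulas -/

lemma eulerE_pow_ne_zero {q : ℂ} (h1 : ‖q‖ < 1) {k : ℕ} (hk : k ≠ 0) : eulerE (q ^ k) ≠ 0 :=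
  eulerE_ne_zero (norm_pow_lt_one h1 hk)

lemma qPochhammerInf_neg_self {q : ℂ} (h1 : ‖q‖ < 1) :
    qPochhammerInf (-q) q = eulerE (q ^ 2) / eulerE q := by
  rw [eq_div_iff (eulerE_ne_zero h1), mul_comm]
  exact qPochhammerInf_mul_neg q h1

lemma qPochhammerInf_two (a : ℂ) {q : ℂ} (h1 : ‖q‖ < 1) :
    qPochhammerInf a q = qPochhammerInf a (q ^ 2) * qPochhammerInf (a * q) (q ^ 2) := by
  rw [qPochhammerInf_dissect a h1 2]
  simp

lemma qPochhammerInf_odd {q : ℂ} (h1 : ‖q‖ < 1) :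
    qPochhammerInf q (q ^ 2) = eulerE q / eulerE (q ^ 2) := by
  rw [eq_div_iff (eulerE_pow_ne_zero h1 two_ne_zero), eulerE, eulerE, qPochhammerInf_two q h1]
  ring_nf

lemma ramanujanPhi_neg {q : ℂ} (h0 : q ≠ 0) (h1 : ‖q‖ < 1) :
    ramanujanPhi (-q) = eulerE q ^ 2 / eulerE (q ^ 2) := by
  rw [ramanujanPhi_eq_thetaPow (neg_ne_zero.mpr h0),
    thetaPow_eq_prod (neg_ne_zero.mpr h0) (by simpa using h1) two_ne_zero]
  have h2 := eulerE_pow_ne_zero h1 two_ne_zero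
  have e : ((2 : ℕ) : ℤ) - 1 = 1 := by norm_num
  rw [e, zpow_one, neg_neg, neg_sq, qPochhammerInf_odd h1]
  field_simp

/-- The `2` is the first factor of `(-1; q)_∞`; it reflects that the exponents run through each
triangular number twice. -/
lemma thetaPow_one_one {q : ℂ} (h0 : q ≠ 0) (h1 : ‖q‖ < 1) :
    thetaPow q 1 1 = 2 * (eulerE (q ^ 2) ^ 2 / eulerE q) := by
  have h2 := eulerE_ne_zero h1
  rw [thetaPow_eq_prod h0 h1 one_ne_zero]
  have e : ((1 : ℕ) : ℤ) - 1 = 0 := by norm_num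
  rw [e, zpow_one, zpow_zero, pow_one, qPochhammerInf_eq_mul (-1) h1, neg_one_mul,
    qPochhammerInf_neg_self h1]
  field_simp
  ring

lemma ramanujanPsi_eq_prod {q : ℂ} (h0 : q ≠ 0) (h1 : ‖q‖ < 1) :
    ramanujanPsi q = eulerE (q ^ 2) ^ 2 / eulerE q := by
  have hE1 := eulerE_ne_zero h1
  have hE2 := eulerE_pow_ne_zero h1 two_ne_zero
  have hE4 := eulerE_pow_ne_zero h1 four_ne_zero
  have h2 := norm_pow_lt_one h1 two_ne_zero
  rw [ramanujanPsi_eq_thetaPow h0, thetaPow_eq_prod h0 h1 four_ne_zero]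
  have e : ((4 : ℕ) : ℤ) - 1 = (3 : ℕ) := by norm_num
  have d1 := qPochhammerInf_two (-q) h1
  have d2 := qPochhammerInf_two (-q) h2
  have d3 := qPochhammerInf_neg_self h2
  rw [qPochhammerInf_neg_self h1] at d1
  rw [← pow_mul] at d2 d3
  have e2 : -q * q = -q ^ 2 := by ring
  have e3 : -q * q ^ 2 = -q ^ 3 := by ring
  rw [e2, d3, d2, e3] at d1
  rw [e, zpow_one, zpow_natCast]
  norm_num at d1
  field_simp at d1 ⊢
  linear_combination -d1

/-- `E⁴(q²) / E²(q) - q E⁴(q¹⁰) / E²(q⁵) = E³(q⁵) E(q²) / (E(q¹⁰) E(q))`. -/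
lemma eulerE_relation_psi {q : ℂ} (h0 : q ≠ 0) (h1 : ‖q‖ < 1) :
    eulerE (q ^ 2) ^ 4 / eulerE q ^ 2 - q * (eulerE (q ^ 10) ^ 4 / eulerE (q ^ 5) ^ 2) =
      eulerE (q ^ 5) ^ 3 * eulerE (q ^ 2) / (eulerE (q ^ 10) * eulerE q) := by
  have hE1 := eulerE_ne_zero h1
  have hE5 := eulerE_pow_ne_zero h1 (k := 5) (by norm_num)
  have hE10 := eulerE_pow_ne_zero h1 (k := 10) (by norm_num)
  have h5 := norm_pow_lt_one h1 (m := 5) (by norm_num)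
  have key := thetaPow_one_one_sq h0 h1
  have e5 : thetaPow q 5 5 = thetaPow (q ^ 5) 1 1 := by
    rw [thetaPow_pow]; norm_num
  -- The two theta products on the right of `key` use the residues `1, 4` and `2, 3` modulo `5`.
  -- Together they form `(-q; q)_∞` with the multiples of `5` removed.
  have d := qPochhammerInf_dissect (-q) h1 5
  have d5 := qPochhammerInf_neg_self h5
  rw [qPochhammerInf_neg_self h1] at d
  simp only [Fin.prod_univ_five] at d
  norm_num [← pow_mul] at d d5
  rw [e5, thetaPow_one_one h0 h1, thetaPow_one_one (pow_ne_zero 5 h0) h5,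
    thetaPow_eq_prod h0 h1 (by norm_num), thetaPow_eq_prod h0 h1 (by norm_num)] at key
  norm_num [← pow_mul] at key
  norm_cast at key
  rw [show -(q * q) = -q ^ 2 by ring, show -(q * q ^ 2) = -q ^ 3 by ring,
    show -(q * q ^ 3) = -q ^ 4 by ring, show -(q * q ^ 4) = -q ^ 5 by ring, d5] at d
  have hp : qPochhammerInf (-q) (q ^ 5) * qPochhammerInf (-q ^ 2) (q ^ 5) *
      qPochhammerInf (-q ^ 3) (q ^ 5) * qPochhammerInf (-q ^ 4) (q ^ 5) =
      eulerE (q ^ 2) * eulerE (q ^ 5) / (eulerE q * eulerE (q ^ 10)) := by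
    field_simp at d ⊢
    linear_combination -d
  linear_combination key / 4 + eulerE (q ^ 5) ^ 2 * hp

/-- `E⁴(q⁵) / E²(q¹⁰) - E⁴(q) / E²(q²) = 4 q E(q) E³(q¹⁰) / (E(q²) E(q⁵))`. -/
lemma eulerE_relation_phi {q : ℂ} (h0 : q ≠ 0) (h1 : ‖q‖ < 1) :
    eulerE (q ^ 5) ^ 4 / eulerE (q ^ 10) ^ 2 - eulerE q ^ 4 / eulerE (q ^ 2) ^ 2 =
      4 * q * (eulerE q * eulerE (q ^ 10) ^ 3 / (eulerE (q ^ 2) * eulerE (q ^ 5))) := by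
  have hE2 := eulerE_pow_ne_zero h1 two_ne_zero
  have hE5 := eulerE_pow_ne_zero h1 (k := 5) (by norm_num)
  have hE10 := eulerE_pow_ne_zero h1 (k := 10) (by norm_num)
  have h5 := norm_pow_lt_one h1 (m := 5) (by norm_num)
  have hn0 : -q ≠ 0 := neg_ne_zero.mpr h0
  have hn1 : ‖-q‖ < 1 := by rwa [norm_neg]
  -- At `-q` the minus signs in the triple products disappear, leaving the odd residues modulo `10`
  -- other than `5`.
  have key := thetaPow_two_one_sq hn0 hn1
  have e5 : thetaPow (-q) 10 5 = ramanujanPhi (-q ^ 5) := by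
    rw [ramanujanPhi_eq_thetaPow (neg_ne_zero.mpr (pow_ne_zero 5 h0)),
      show -q ^ 5 = (-q) ^ 5 by ring, thetaPow_pow]
    norm_num
  have d := qPochhammerInf_dissect q (norm_pow_lt_one h1 two_ne_zero) 5
  have d5 := qPochhammerInf_odd h5
  rw [qPochhammerInf_odd h1] at d
  simp only [Fin.prod_univ_five] at d
  norm_num [← pow_mul] at d d5
  rw [e5, ← ramanujanPhi_eq_thetaPow hn0, ramanujanPhi_neg h0 h1,
    ramanujanPhi_neg (pow_ne_zero 5 h0) h5, thetaPow_eq_prod hn0 hn1 (by norm_num),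
    thetaPow_eq_prod hn0 hn1 (by norm_num)] at key
  norm_num [← pow_mul] at key
  norm_cast at key
  rw [show -(-q) ^ 9 = q ^ 9 by ring, show -(-q) ^ 7 = q ^ 7 by ring,
    show -(-q) ^ 3 = q ^ 3 by ring] at key
  rw [show q * q ^ 2 = q ^ 3 by ring, show q * q ^ 4 = q ^ 5 by ring,
    show q * q ^ 6 = q ^ 7 by ring, show q * q ^ 8 = q ^ 9 by ring, d5] at d
  have hp : qPochhammerInf q (q ^ 10) * qPochhammerInf (q ^ 3) (q ^ 10) *
      qPochhammerInf (q ^ 7) (q ^ 10) * qPochhammerInf (q ^ 9) (q ^ 10) =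
      eulerE q * eulerE (q ^ 10) / (eulerE (q ^ 2) * eulerE (q ^ 5)) := by
    field_simp at d ⊢
    linear_combination -d
  linear_combination -key + 4 * q * eulerE (q ^ 10) ^ 2 * hp

/-! ### The four theta function identities -/

lemma theta_identities {q : ℂ} (h0 : q ≠ 0) (h1 : ‖q‖ < 1) :
    ramanujanPhi (-q) * ramanujanPhi (-q ^ 5) ^ 3 =
        (eulerE q ^ 5 / eulerE (q ^ 5) + 4 * (eulerE (q ^ 2) ^ 5 / eulerE (q ^ 10))) / 5
        - (q * (eulerE (q ^ 5) ^ 5 / eulerE q)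
            - 4 * q ^ 2 * (eulerE (q ^ 10) ^ 5 / eulerE (q ^ 2))) ∧
    ramanujanPhi (-q) ^ 3 * ramanujanPhi (-q ^ 5) =
        (eulerE q ^ 5 / eulerE (q ^ 5) + 4 * (eulerE (q ^ 2) ^ 5 / eulerE (q ^ 10))) / 5
        - 5 * (q * (eulerE (q ^ 5) ^ 5 / eulerE q)
            - 4 * q ^ 2 * (eulerE (q ^ 10) ^ 5 / eulerE (q ^ 2))) ∧
    4 * q * ramanujanPsi q ^ 3 * ramanujanPsi (q ^ 5) =
        (eulerE q ^ 5 / eulerE (q ^ 5) - eulerE (q ^ 2) ^ 5 / eulerE (q ^ 10)) / 5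
        + 5 * (q * (eulerE (q ^ 5) ^ 5 / eulerE q)
            + q ^ 2 * (eulerE (q ^ 10) ^ 5 / eulerE (q ^ 2))) ∧
    4 * q ^ 2 * ramanujanPsi q * ramanujanPsi (q ^ 5) ^ 3 =
        (eulerE q ^ 5 / eulerE (q ^ 5) - eulerE (q ^ 2) ^ 5 / eulerE (q ^ 10)) / 5
        + (q * (eulerE (q ^ 5) ^ 5 / eulerE q)
            + q ^ 2 * (eulerE (q ^ 10) ^ 5 / eulerE (q ^ 2))) := by
  have hE1 := eulerE_ne_zero h1
  have hE2 := eulerE_pow_ne_zero h1 two_ne_zero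
  have hE5 := eulerE_pow_ne_zero h1 (k := 5) (by norm_num)
  have hE10 := eulerE_pow_ne_zero h1 (k := 10) (by norm_num)
  have h5 := norm_pow_lt_one h1 (m := 5) (by norm_num)
  have p1 := ramanujanPhi_neg h0 h1
  have p5 := ramanujanPhi_neg (pow_ne_zero 5 h0) h5
  have s1 := ramanujanPsi_eq_prod h0 h1
  have s5 := ramanujanPsi_eq_prod (pow_ne_zero 5 h0) h5
  have r1 := eulerE_relation_psi h0 h1
  have r2 := eulerE_relation_phi h0 h1
  rw [← pow_mul] at p5 s5
  norm_num at p5 s5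
  rw [p1, p5, s1, s5]
  clear p1 p5 s1 s5 h1 h5
  generalize eulerE q = E1 at *
  generalize eulerE (q ^ 2) = E2 at *
  generalize eulerE (q ^ 5) = E5 at *
  generalize eulerE (q ^ 10) = E10 at *
  -- everything is a rational function of `t`, up to the common factor `D`
  obtain ⟨t, ht⟩ : ∃ t, t = E2 * E5 ^ 5 / (q * E1 * E10 ^ 5) := ⟨_, rfl⟩
  obtain ⟨D, hD⟩ : ∃ D, D = q ^ 2 * (E10 ^ 5 / E2) := ⟨_, rfl⟩
  have ht0 : t ≠ 0 := by rw [ht]; positivity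
  -- `r1` divided by `q E10⁴ / E5²`, and below `r2` divided by `q E1 E10³ / (E2 E5)`.
  have hu : E2 ^ 4 * E5 ^ 2 / (q * E1 ^ 2 * E10 ^ 4) = t + 1 := by
    rw [ht]; field_simp at r1 ⊢; linear_combination r1
  have hw : E1 ^ 3 * E5 / (q * E2 * E10 ^ 3) = t - 4 := by
    rw [ht]; field_simp at r2 ⊢; linear_combination -r2
  have hC : q * (E5 ^ 5 / E1) = D * t := by rw [hD, ht]; field_simp
  have hB : E2 ^ 5 / E10 = D * ((t + 1) ^ 2 * (t - 4) / t) := by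
    rw [hD, ← hu, ← hw, ht]; field_simp
  have hA : E1 ^ 5 / E5 = D * ((t + 1) * (t - 4) ^ 2 / t) := by
    rw [hD, ← hu, ← hw, ht]; field_simp
  have hp1 : E1 ^ 2 / E2 * (E5 ^ 2 / E10) ^ 3 = D * (t * (t - 4)) := by
    rw [hD, ← hw, ht]; field_simp
  have hp2 : (E1 ^ 2 / E2) ^ 3 * (E5 ^ 2 / E10) = D * (t - 4) ^ 2 := by
    rw [hD, ← hw]; field_simp
  have hs1 : q * (E2 ^ 2 / E1) ^ 3 * (E10 ^ 2 / E5) = D * ((t + 1) ^ 2 / t) := by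
    rw [hD, ← hu, ht]; field_simp
  have hs2 : q ^ 2 * (E2 ^ 2 / E1) * (E10 ^ 2 / E5) ^ 3 = D * ((t + 1) / t) := by
    rw [hD, ← hu, ht]; field_simp
  refine ⟨?_, ?_, ?_, ?_⟩
  · rw [hp1, hA, hB, hC, mul_assoc 4, ← hD]; field_simp; ring
  · rw [hp2, hA, hB, hC, mul_assoc 4, ← hD]; field_simp; ring
  · rw [mul_assoc 4, mul_assoc 4, hs1, hA, hB, hC, ← hD]; field_simp; ring
  · rw [mul_assoc 4, mul_assoc 4, hs2, hA, hB, hC, ← hD]; field_simp; ring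

/-! ### Termwise differentiation of Laurent series in `exp z` -/

/-- A linear factor is absorbed by `exp (δ |t|)`, which moves `σ` by `δ` to one side according to
the sign of `t`. Hence differentiating a Laurent series termwise preserves absolute convergence on
an open strip. -/
lemma abs_mul_exp_le {δ : ℝ} (hδ : 0 < δ) (σ t : ℝ) :
    |t| * Real.exp (t * σ) ≤
      δ⁻¹ * (Real.exp (t * (σ - δ)) + Real.exp (t * (σ + δ))) := by
  have h1 : δ * |t| ≤ Real.exp (δ * |t|) := by
    linarith [Real.add_one_le_exp (δ * |t|)]
  have h2 : Real.exp (δ * |t|) * Real.exp (t * σ) ≤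
      Real.exp (t * (σ - δ)) + Real.exp (t * (σ + δ)) := by
    rw [← Real.exp_add]
    rcases abs_cases t with ⟨h, _⟩ | ⟨h, _⟩
    · rw [h, show δ * t + t * σ = t * (σ + δ) by ring]
      linarith [Real.exp_pos (t * (σ - δ))]
    · rw [h, show δ * -t + t * σ = t * (σ - δ) by ring]
      linarith [Real.exp_pos (t * (σ + δ))]
  rw [inv_mul_eq_div, le_div_iff₀ hδ]
  calc |t| * Real.exp (t * σ) * δ = δ * |t| * Real.exp (t * σ) := by ring
    _ ≤ Real.exp (δ * |t|) * Real.exp (t * σ) := by gcongr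
    _ ≤ _ := h2

/-- The two ends of an interval dominate everything between them, which supplies the majorant,
uniform on a ball, needed for termwise differentiation. -/
lemma exp_mul_le_add {r : ℝ} {σ τ : ℝ} (h : |τ - σ| ≤ r) (t : ℝ) :
    Real.exp (t * τ) ≤ Real.exp (t * (σ - r)) + Real.exp (t * (σ + r)) := by
  obtain ⟨h1, h2⟩ := abs_le.mp h
  rcases le_total 0 t with ht | ht
  · have : Real.exp (t * τ) ≤ Real.exp (t * (σ + r)) :=
      Real.exp_le_exp.mpr (by nlinarith)
    linarith [Real.exp_pos (t * (σ - r))]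
  · have : Real.exp (t * τ) ≤ Real.exp (t * (σ - r)) :=
      Real.exp_le_exp.mpr (by nlinarith)
    linarith [Real.exp_pos (t * (σ + r))]

/-- The Laurent series `∑ cₙ exp(n z)` converges absolutely on the strip `Re z ∈ S`. -/
def LaurentSummable (c : ℤ → ℂ) (S : Set ℝ) : Prop :=
  ∀ σ ∈ S, Summable fun n : ℤ => ‖c n‖ * Real.exp (n * σ)

/-- The Laurent series `∑ cₙ exp(n z)`. -/
noncomputable def laurentSum (c : ℤ → ℂ) (z : ℂ) : ℂ := ∑' n : ℤ, c n * Complex.exp (n * z)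

lemma LaurentSummable.summable_norm {c : ℤ → ℂ} {S : Set ℝ} (hc : LaurentSummable c S) {z : ℂ}
    (hz : z.re ∈ S) : Summable fun n : ℤ => ‖c n * Complex.exp (n * z)‖ := by
  refine (hc _ hz).congr fun n => ?_
  rw [norm_mul, Complex.norm_exp]
  simp

lemma exists_sub_add_mem {S : Set ℝ} (hS : IsOpen S) {σ : ℝ} (hσ : σ ∈ S) :
    ∃ δ > 0, σ - δ ∈ S ∧ σ + δ ∈ S := by
  obtain ⟨ε, hε, h⟩ := Metric.isOpen_iff.mp hS σ hσ
  refine ⟨ε / 2, half_pos hε, h ?_, h ?_⟩ <;>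
    simp [abs_of_pos hε, hε]

lemma LaurentSummable.mul {c : ℤ → ℂ} {S : Set ℝ} (hS : IsOpen S) (hc : LaurentSummable c S) :
    LaurentSummable (fun n => n * c n) S := by
  intro σ hσ
  obtain ⟨δ, hδ, h1, h2⟩ := exists_sub_add_mem hS hσ
  refine Summable.of_nonneg_of_le (fun n => by positivity) (fun n => ?_)
    (((hc _ h1).add (hc _ h2)).mul_left δ⁻¹)
  have := mul_le_mul_of_nonneg_left (abs_mul_exp_le hδ σ n) (norm_nonneg (c n))
  rw [norm_mul, Complex.norm_intCast]
  linarith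

lemma LaurentSummable.hasDerivAt {c : ℤ → ℂ} {S : Set ℝ} (hS : IsOpen S)
    (hc : LaurentSummable c S) {z : ℂ} (hz : z.re ∈ S) :
    HasDerivAt (laurentSum c) (laurentSum (fun n => n * c n) z) z := by
  obtain ⟨δ, hδ, h1, h2⟩ := exists_sub_add_mem hS hz
  have hd := hc.mul hS
  refine hasDerivAt_tsum_of_isPreconnected (t := Metric.ball z δ) (y₀ := z)
    (g := fun n w => c n * Complex.exp (n * w))
    (g' := fun n w => n * c n * Complex.exp (n * w))
    ((hd _ h1).add (hd _ h2)) Metric.isOpen_ball (convex_ball z δ).isPreconnected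
    (fun n w _ => ?_) (fun n w hw => ?_) (Metric.mem_ball_self hδ) (hc.summable_norm hz).of_norm
    (Metric.mem_ball_self hδ)
  · have := (((hasDerivAt_id w).const_mul (n : ℂ)).cexp).const_mul (c n)
    simp only [id] at this
    exact this.congr_deriv (by ring)
  · have hw' : |w.re - z.re| ≤ δ := by
      rw [← Complex.sub_re]
      exact (Complex.abs_re_le_norm _).trans (mem_ball_iff_norm.mp hw).le
    have := mul_le_mul_of_nonneg_left (exp_mul_le_add hw' n) (norm_nonneg ((n : ℂ) * c n))
    rw [norm_mul, Complex.norm_exp]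
    simpa [mul_add] using this

/-! ### The logarithm of the triple product -/

lemma norm_one_sub_pow_ge {q : ℂ} (h1 : ‖q‖ < 1) {k : ℕ} (hk : k ≠ 0) :
    1 - ‖q‖ ≤ ‖1 - q ^ k‖ := by
  have h2 : ‖q ^ k‖ ≤ ‖q‖ := by
    rw [norm_pow]; exact pow_le_of_le_one (norm_nonneg _) h1.le hk
  have h3 := norm_sub_norm_le (1 : ℂ) (q ^ k)
  rw [norm_one] at h3
  linarith

lemma one_sub_pow_ne_zero {q : ℂ} (h1 : ‖q‖ < 1) {k : ℕ} (hk : k ≠ 0) : 1 - q ^ k ≠ 0 := by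
  intro h
  have := norm_one_sub_pow_ge h1 hk
  rw [h, norm_zero] at this
  linarith

/-- Expand each `log (1 - a qⁿ)` and sum the geometric series over `n` first. The term `k = 0` is
zero because division by zero gives zero. -/
lemma qPochhammerInf_eq_exp {a q : ℂ} (h1 : ‖q‖ < 1) (ha : ‖a‖ < 1) :
    qPochhammerInf a q = Complex.exp (-∑' k : ℕ, a ^ k / (k * (1 - q ^ k))) := by
  have hlt : ∀ n : ℕ, ‖a * q ^ n‖ < 1 := fun n => by
    rw [norm_mul, norm_pow]
    exact mul_lt_one_of_nonneg_of_lt_one_left (norm_nonneg _) ha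
      (pow_le_one₀ (norm_nonneg _) h1.le)
  have hne : ∀ n : ℕ, 1 - a * q ^ n ≠ 0 := fun n h => by
    have := hlt n
    rw [← sub_eq_zero.mp h, norm_one] at this
    exact lt_irrefl _ this
  have hF : Summable fun p : ℕ × ℕ => (a * q ^ p.1) ^ p.2 / p.2 := by
    refine Summable.of_norm_bounded
      (g := fun p : ℕ × ℕ => ‖q‖ ^ p.1 * ‖a‖ ^ p.2)
      ((summable_geometric_of_lt_one (norm_nonneg _) h1).mul_of_nonneg
        (summable_geometric_of_lt_one (norm_nonneg _) ha) (fun _ => by positivity)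
        (fun _ => by positivity)) ?_
    rintro ⟨n, k⟩
    rcases Nat.eq_zero_or_pos k with rfl | hk
    · simp
    · have hk1 : (1 : ℝ) ≤ k := by exact_mod_cast hk
      simp only [norm_div, norm_pow, norm_mul, Complex.norm_natCast]
      calc (‖a‖ * ‖q‖ ^ n) ^ k / k ≤ (‖a‖ * ‖q‖ ^ n) ^ k :=
            div_le_self (by positivity) hk1
        _ = (‖q‖ ^ n) ^ k * ‖a‖ ^ k := by ring
        _ ≤ ‖q‖ ^ n * ‖a‖ ^ k := by
            gcongr
            exact pow_le_of_le_one (by positivity) (pow_le_one₀ (norm_nonneg _) h1.le) hk.ne'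
  have hlog : ∀ n : ℕ, HasSum (fun k : ℕ => (a * q ^ n) ^ k / k)
      (-Complex.log (1 - a * q ^ n)) := fun n => Complex.hasSum_taylorSeries_neg_log (hlt n)
  have hsum : HasSum (fun n : ℕ => -Complex.log (1 - a * q ^ n))
      (∑' p : ℕ × ℕ, (a * q ^ p.1) ^ p.2 / p.2) := hF.hasSum.prod_fiberwise hlog
  have hcol : ∀ k : ℕ, HasSum (fun n : ℕ => (a * q ^ n) ^ k / k) (a ^ k / (k * (1 - q ^ k))) := by
    intro k
    rcases Nat.eq_zero_or_pos k with rfl | hk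
    · simp
    · have := (hasSum_geometric_of_norm_lt_one (norm_pow_lt_one h1 hk.ne')).mul_left (a ^ k / k)
      rw [show a ^ k / (k * (1 - q ^ k)) = a ^ k / k * (1 - q ^ k)⁻¹ by
        rw [div_mul_eq_div_div, div_eq_mul_inv _ (1 - q ^ k)]]
      refine this.congr_fun fun n => ?_
      rw [mul_pow, ← pow_mul, ← pow_mul, mul_comm n k]
      ring
  have hsum2 : HasSum (fun k : ℕ => a ^ k / (k * (1 - q ^ k)))
      (∑' p : ℕ × ℕ, (a * q ^ p.1) ^ p.2 / p.2) := by
    have := (Equiv.prodComm ℕ ℕ).hasSum_iff.mpr hF.hasSum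
    exact this.prod_fiberwise hcol
  have h3 := hsum.neg
  simp only [neg_neg] at h3
  rw [qPochhammerInf, ← Complex.cexp_tsum_eq_tprod hne h3.summable, h3.tsum_eq, hsum2.tsum_eq]

/-- The coefficients of the logarithm of `1 / ((q x; q)_∞ (q / x; q)_∞)` as a Laurent series. -/
noncomputable def logCoeff (q : ℂ) (k : ℤ) : ℂ :=
  q ^ k.natAbs / (k.natAbs * (1 - q ^ k.natAbs))

/-- The annulus `|q| < |x| < |q|⁻¹`, in logarithmic coordinates. -/
def logAnnulus (q : ℂ) : Set ℝ := Set.Ioo (Real.log ‖q‖) (-Real.log ‖q‖)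

lemma norm_mul_exp_lt_one {q : ℂ} (h0 : q ≠ 0) {σ : ℝ} (hσ : σ ∈ logAnnulus q) :
    ‖q‖ * Real.exp σ < 1 ∧ ‖q‖ * Real.exp (-σ) < 1 := by
  have hq : ‖q‖ = Real.exp (Real.log ‖q‖) := (Real.exp_log (norm_pos_iff.mpr h0)).symm
  obtain ⟨h1, h2⟩ := hσ
  constructor
  · rw [hq, ← Real.exp_add, Real.exp_lt_one_iff]; linarith
  · rw [hq, ← Real.exp_add, Real.exp_lt_one_iff]; linarith

lemma norm_logCoeff_le {q : ℂ} (h1 : ‖q‖ < 1) (k : ℤ) :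
    ‖logCoeff q k‖ ≤ ‖q‖ ^ k.natAbs / (1 - ‖q‖) := by
  have hq : 0 < 1 - ‖q‖ := by linarith
  rcases Nat.eq_zero_or_pos k.natAbs with h | h
  · rw [logCoeff, h]
    simp [hq.le]
  · rw [logCoeff, norm_div, norm_pow, norm_mul, Complex.norm_natCast]
    have h2 : (1 : ℝ) ≤ k.natAbs := by exact_mod_cast h
    have h3 := norm_one_sub_pow_ge h1 h.ne'
    gcongr
    nlinarith

lemma laurentSummable_logCoeff {q : ℂ} (h0 : q ≠ 0) (h1 : ‖q‖ < 1) :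
    LaurentSummable (logCoeff q) (logAnnulus q) := by
  intro σ hσ
  obtain ⟨h2, h3⟩ := norm_mul_exp_lt_one h0 hσ
  have key : ∀ τ : ℝ, ‖q‖ * Real.exp τ < 1 →
      Summable fun n : ℕ => ‖q‖ ^ n / (1 - ‖q‖) * Real.exp (n * τ) := by
    intro τ hτ
    refine ((summable_geometric_of_lt_one (by positivity) hτ).mul_left (1 - ‖q‖)⁻¹).congr
      fun n => ?_
    rw [mul_pow, ← Real.exp_nat_mul]
    ring
  refine Summable.of_nonneg_of_le (fun n => by positivity)
    (fun n => mul_le_mul_of_nonneg_right (norm_logCoeff_le h1 n) (Real.exp_pos _).le)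
    (Summable.of_nat_of_neg ?_ ?_)
  · simpa using key σ h2
  · simpa using key (-σ) h3

lemma qPochhammerInf_mul_eq_exp {q : ℂ} (h0 : q ≠ 0) (h1 : ‖q‖ < 1) {z : ℂ}
    (hz : z.re ∈ logAnnulus q) :
    qPochhammerInf (Complex.exp z * q) q * qPochhammerInf (q / Complex.exp z) q =
      Complex.exp (-laurentSum (logCoeff q) z) := by
  obtain ⟨h2, h3⟩ := norm_mul_exp_lt_one h0 hz
  have ha : ‖Complex.exp z * q‖ < 1 := by
    rw [norm_mul, Complex.norm_exp, mul_comm]; exact h2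
  have hb : ‖q / Complex.exp z‖ < 1 := by
    rw [div_eq_mul_inv, ← Complex.exp_neg, norm_mul, Complex.norm_exp]; exact h3
  have hs := ((laurentSummable_logCoeff h0 h1).summable_norm hz).of_norm
  have hp : Summable fun n : ℕ => logCoeff q n * Complex.exp ((n : ℤ) * z) :=
    hs.comp_injective Nat.cast_injective
  have hn : Summable fun n : ℕ => logCoeff q (-n) * Complex.exp ((-n : ℤ) * z) :=
    hs.comp_injective (i := fun n : ℕ => (-n : ℤ)) fun a b h => by simpa using h
  have hsum := (hp.hasSum.of_nat_of_neg (f := fun n : ℤ => logCoeff q n * Complex.exp (n * z))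
    hn.hasSum).tsum_eq
  rw [laurentSum, hsum, qPochhammerInf_eq_exp h1 ha, qPochhammerInf_eq_exp h1 hb,
    ← Complex.exp_add]
  have e0 : logCoeff q 0 = 0 := by simp [logCoeff]
  rw [e0, zero_mul, sub_zero, neg_add]
  congr 3
  · refine tsum_congr fun n => ?_
    rw [logCoeff, mul_pow, ← Complex.exp_nat_mul]
    simp only [Int.natAbs_natCast, Int.cast_natCast]
    ring
  · refine tsum_congr fun n => ?_
    rw [logCoeff, div_eq_mul_inv q, ← Complex.exp_neg, mul_pow, ← Complex.exp_nat_mul]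
    simp only [Int.natAbs_neg, Int.natAbs_natCast, Int.cast_neg, Int.cast_natCast, mul_neg,
      neg_mul]
    ring

/-! ### A quadratic theta function identity -/

/-- The splitting of `ℤ × ℤ` by the parity of the sum of the coordinates. -/
def parityEquiv : Fin 2 × (ℤ × ℤ) ≃ ℤ × ℤ where
  toFun p := (p.2.1 + p.2.2 + (p.1 : ℕ), p.2.1 - p.2.2)
  invFun v := (⟨((v.1 + v.2) % 2).toNat, by omega⟩, ((v.1 + v.2) / 2, (v.1 + v.2) / 2 - v.2))
  left_inv := by
    rintro ⟨⟨j, hj⟩, m, n⟩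
    simp only [Prod.mk.injEq, Fin.mk.injEq]
    refine ⟨?_, ?_, ?_⟩ <;> omega
  right_inv := by
    rintro ⟨x, y⟩
    simp only [Prod.mk.injEq]
    constructor <;> omega

/-- Half-sum and half-difference coordinates separate the variables in each parity class. The sign
in `h'` anticipates the factor `(-1)^{m+n}` on the odd class. -/
lemma tsum_parity {F : ℤ × ℤ → ℂ} (hF : Summable F) {f g f' g' : ℤ → ℂ}
    (h : ∀ r s, F (r + s, r - s) = f r * g s)
    (h' : ∀ r s, F (r + s + 1, r - s) = -(f' r * g' s)) :
    ∑' v, F v = (∑' r, f r) * (∑' s, g s) - (∑' r, f' r) * ∑' s, g' s := by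
  have hs := parityEquiv.summable_iff.mpr hF
  have e : ∀ {u w : ℤ → ℂ}, Summable (fun v : ℤ × ℤ => u v.1 * w v.2) →
      ∑' v : ℤ × ℤ, u v.1 * w v.2 = (∑' r, u r) * ∑' s, w s := by
    intro u w hu
    rw [hu.tsum_prod]
    simp only [tsum_mul_left, tsum_mul_right]
  have s0 : Summable fun v : ℤ × ℤ => f v.1 * g v.2 :=
    (hs.comp_injective (Prod.mk_right_injective (0 : Fin 2))).congr fun v => by
      simp [parityEquiv, h]
  have s1 : Summable fun v : ℤ × ℤ => f' v.1 * g' v.2 :=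
    ((hs.comp_injective (Prod.mk_right_injective (1 : Fin 2))).neg).congr fun v => by
      simp [parityEquiv, h']
  have hsum := hs.tsum_prod
  rw [← e s0, ← e s1, sub_eq_add_neg, ← tsum_neg]
  calc ∑' v, F v = ∑' v, (F ∘ parityEquiv) v := (parityEquiv.tsum_eq F).symm
    _ = ∑ j : Fin 2, ∑' v, (F ∘ parityEquiv) (j, v) := by rw [hsum, tsum_fintype]
    _ = _ := by
      rw [Fin.sum_univ_two]
      congr 1
      · exact tsum_congr fun v => by simp [parityEquiv, h]
      · exact tsum_congr fun v => by simp [parityEquiv, h']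

/-- The iterated logarithmic derivatives of the theta function. -/
noncomputable def thetaMoment (q : ℂ) (k : ℕ) (x : ℂ) : ℂ :=
  ∑' n : ℤ, (n : ℂ) ^ k * (thetaCoeff q n * x ^ n)

lemma thetaMoment_zero (q x : ℂ) : thetaMoment q 0 x = theta x q := by
  simp [thetaMoment, theta]

lemma thetaMoment_exp (q : ℂ) (k : ℕ) (z : ℂ) :
    thetaMoment q k (Complex.exp z) = laurentSum (fun n => n ^ k * thetaCoeff q n) z := by
  refine tsum_congr fun n => ?_
  rw [← Complex.exp_int_mul, mul_assoc]

lemma laurentSummable_thetaCoeff {q : ℂ} (h0 : q ≠ 0) (h1 : ‖q‖ < 1) (k : ℕ) :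
    LaurentSummable (fun n => n ^ k * thetaCoeff q n) Set.univ := by
  induction k with
  | zero =>
    intro σ _
    refine (summable_zpow_tri (norm_pos_iff.mpr h0) h1 σ).congr fun n => ?_
    simp only [pow_zero, one_mul, norm_thetaCoeff]
  | succ k ih =>
    have := ih.mul isOpen_univ
    simpa only [pow_succ', mul_assoc] using this

lemma summable_norm_thetaMoment {q x : ℂ} (h0 : q ≠ 0) (h1 : ‖q‖ < 1) (hx : x ≠ 0) (k : ℕ) :
    Summable fun n : ℤ => ‖(n : ℂ) ^ k * (thetaCoeff q n * x ^ n)‖ := by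
  refine (laurentSummable_thetaCoeff h0 h1 k (Real.log ‖x‖) (Set.mem_univ _)).congr fun n => ?_
  rw [← mul_assoc, norm_mul (_ * _), norm_zpow, norm_zpow_eq_exp hx]

lemma hasDerivAt_thetaMoment {q : ℂ} (h0 : q ≠ 0) (h1 : ‖q‖ < 1) (k : ℕ) (z : ℂ) :
    HasDerivAt (fun w => thetaMoment q k (Complex.exp w))
      (thetaMoment q (k + 1) (Complex.exp z)) z := by
  have := (laurentSummable_thetaCoeff h0 h1 k).hasDerivAt isOpen_univ (Set.mem_univ z.re)
  simp only [thetaMoment_exp]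
  simpa only [pow_succ', mul_assoc] using this

lemma thetaCoeff_mul_even {q : ℂ} (h0 : q ≠ 0) (r s : ℤ) :
    thetaCoeff q (r + s) * thetaCoeff q (r - s) = q ^ (r ^ 2 - r) * q ^ (s ^ 2) := by
  have e : tri (r + s) + tri (r - s) = r ^ 2 - r + s ^ 2 := by
    have e1 := two_mul_tri (r + s)
    have e2 := two_mul_tri (r - s)
    linarith
  rw [thetaCoeff, thetaCoeff, mul_mul_mul_comm, ← zpow_add₀ h0, e, ← zpow_add₀ h0,
    ← zpow_add₀ (by norm_num : (-1 : ℂ) ≠ 0), Even.neg_one_zpow ⟨r, by ring⟩, one_mul]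

lemma thetaCoeff_mul_odd {q : ℂ} (h0 : q ≠ 0) (r s : ℤ) :
    thetaCoeff q (r + s + 1) * thetaCoeff q (r - s) = -(q ^ (r ^ 2) * q ^ (s ^ 2 + s)) := by
  have e : tri (r + s + 1) + tri (r - s) = r ^ 2 + (s ^ 2 + s) := by
    have e1 := two_mul_tri (r + s + 1)
    have e2 := two_mul_tri (r - s)
    linarith
  rw [thetaCoeff, thetaCoeff, mul_mul_mul_comm, ← zpow_add₀ h0, e, ← zpow_add₀ h0,
    ← zpow_add₀ (by norm_num : (-1 : ℂ) ≠ 0), Odd.neg_one_zpow ⟨r, by ring⟩, neg_one_mul]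

/-- The even part `∑ q^{r² - r} x^{2r}` of a product of two theta functions. -/
noncomputable def thetaEven (q x : ℂ) : ℂ := ∑' r : ℤ, q ^ (r ^ 2 - r) * x ^ (2 * r)

/-- The odd part `∑ q^{r²} x^{2r + 1}` of a product of two theta functions. -/
noncomputable def thetaOdd (q x : ℂ) : ℂ := ∑' r : ℤ, q ^ (r ^ 2) * x ^ (2 * r + 1)

/-- The monomial `(x y)^m (x / y)^n = x^{m+n} y^{m-n}` and the exponent of `q` both separate in the
parity coordinates. The extra factor `y` makes the result a determinant. -/
lemma mul_theta_mul_theta {q x y : ℂ} (h0 : q ≠ 0) (h1 : ‖q‖ < 1) (hx : x ≠ 0) (hy : y ≠ 0) :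
    y * (theta (x * y) q * theta (x / y) q) =
      thetaEven q x * thetaOdd q y - thetaOdd q x * thetaEven q y := by
  have s1 := summable_norm_theta h0 h1 (mul_ne_zero hx hy)
  have s2 := summable_norm_theta h0 h1 (div_ne_zero hx hy)
  have key := tsum_parity (summable_mul_of_summable_norm s1 s2)
    (f := fun r => q ^ (r ^ 2 - r) * x ^ (2 * r)) (g := fun s => q ^ (s ^ 2) * y ^ (2 * s))
    (f' := fun r => q ^ (r ^ 2) * x ^ (2 * r + 1))
    (g' := fun s => q ^ (s ^ 2 + s) * y ^ (2 * s + 1))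
    (fun r s => by
      have := thetaCoeff_mul_even h0 r s
      rw [mul_mul_mul_comm, this, mul_zpow, div_zpow, two_mul, two_mul, zpow_add₀ hx, zpow_add₀ hx,
        zpow_add₀ hy, zpow_sub₀ hx, zpow_sub₀ hy, zpow_add₀ hy]
      have := zpow_ne_zero s hx
      have := zpow_ne_zero r hy
      field_simp)
    (fun r s => by
      have := thetaCoeff_mul_odd h0 r s
      rw [mul_mul_mul_comm, this, mul_zpow, div_zpow, two_mul, two_mul]
      simp only [zpow_add₀ hx, zpow_add₀ hy, zpow_sub₀ hx, zpow_sub₀ hy, zpow_one]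
      have := zpow_ne_zero s hx
      have := zpow_ne_zero r hy
      field_simp)
  rw [← tsum_mul_tsum_of_summable_norm s1 s2] at key
  have e1 : y * ∑' s : ℤ, q ^ (s ^ 2) * y ^ (2 * s) = thetaOdd q y := by
    rw [thetaOdd, ← tsum_mul_left]
    refine tsum_congr fun s => ?_
    rw [zpow_add_one₀ hy]
    ring
  have e2 : y * ∑' s : ℤ, q ^ (s ^ 2 + s) * y ^ (2 * s + 1) = thetaEven q y := by
    rw [thetaEven, ← (Equiv.addRight (1 : ℤ)).tsum_eq fun r => q ^ (r ^ 2 - r) * y ^ (2 * r),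
      ← tsum_mul_left]
    refine tsum_congr fun s => ?_
    rw [Equiv.coe_addRight, show (s + 1) ^ 2 - (s + 1) = s ^ 2 + s by ring,
      show 2 * (s + 1) = 2 * s + 1 + 1 by ring, zpow_add_one₀ hy (2 * s + 1)]
    ring
  change y * ((∑' n : ℤ, thetaCoeff q n * (x * y) ^ n) *
    ∑' n : ℤ, thetaCoeff q n * (x / y) ^ n) = _
  rw [key, ← e1, ← e2, thetaEven, thetaOdd]
  ring

/-- The function `(D θ)² - θ D² θ`, where `D = x d/dx`. -/
noncomputable def thetaHess (q x : ℂ) : ℂ :=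
  thetaMoment q 1 x ^ 2 - thetaMoment q 0 x * thetaMoment q 2 x

/-- After symmetrising, the double series carries the weight `m² + n² - 2mn = (m - n)²`, which
involves only the coordinate `s`. The `x`-series are thus those of the product formula, and the
`s`-series become constants. -/
lemma exists_thetaHess_eq {q : ℂ} (h0 : q ≠ 0) (h1 : ‖q‖ < 1) :
    ∃ α β : ℂ, ∀ x : ℂ, x ≠ 0 → thetaHess q x = α * thetaEven q x + β * thetaOdd q x := by
  refine ⟨-(∑' s : ℤ, q ^ (s ^ 2) * (2 * s) ^ 2) / 2,
    (∑' s : ℤ, q ^ (s ^ 2 + s) * (2 * s + 1) ^ 2) / 2, fun x hx => ?_⟩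
  have s0 := summable_norm_thetaMoment h0 h1 hx 0
  have s1 := summable_norm_thetaMoment h0 h1 hx 1
  have s2 := summable_norm_thetaMoment h0 h1 hx 2
  have p11 := tsum_mul_tsum_of_summable_norm s1 s1
  have p02 := tsum_mul_tsum_of_summable_norm s0 s2
  have p20 := tsum_mul_tsum_of_summable_norm s2 s0
  have t11 := (summable_mul_of_summable_norm s1 s1).hasSum.mul_left 2
  have t02 := (summable_mul_of_summable_norm s0 s2).hasSum
  have t20 := (summable_mul_of_summable_norm s2 s0).hasSum
  have tt := (t20.add t02).sub t11
  rw [← p11, ← p02, ← p20] at tt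
  have key := tsum_parity tt.summable
    (f := fun r => q ^ (r ^ 2 - r) * x ^ (2 * r)) (g := fun s => q ^ (s ^ 2) * (2 * s) ^ 2)
    (f' := fun r => q ^ (r ^ 2) * x ^ (2 * r + 1))
    (g' := fun s => q ^ (s ^ 2 + s) * (2 * s + 1) ^ 2)
    (fun r s => by
      have := thetaCoeff_mul_even h0 r s
      have hxx : x ^ (r + s) * x ^ (r - s) = x ^ (2 * r) := by
        rw [← zpow_add₀ hx]; ring_nf
      rw [← hxx]
      push_cast
      linear_combination ((2 * s) ^ 2 * (x ^ (r + s) * x ^ (r - s))) * this)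
    (fun r s => by
      have := thetaCoeff_mul_odd h0 r s
      have hxx : x ^ (r + s + 1) * x ^ (r - s) = x ^ (2 * r + 1) := by
        rw [← zpow_add₀ hx]; ring_nf
      rw [← hxx]
      push_cast
      linear_combination ((2 * s + 1) ^ 2 * (x ^ (r + s + 1) * x ^ (r - s))) * this)
  rw [tt.tsum_eq] at key
  simp only [thetaHess, thetaMoment, thetaEven, thetaOdd]
  linear_combination (-1 / 2) * key

/-- By the product formula at `y = 1`, `θ²` lies in the same two-dimensional span as `thetaHess`.
The antisymmetric combination is therefore a multiple of the determinant of the two basis series. -/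
lemma exists_thetaHess_mul_sub {q : ℂ} (h0 : q ≠ 0) (h1 : ‖q‖ < 1) :
    ∃ K : ℂ, ∀ x y : ℂ, x ≠ 0 → y ≠ 0 →
      thetaHess q x * theta y q ^ 2 - thetaHess q y * theta x q ^ 2 =
        K * (y * (theta (x * y) q * theta (x / y) q)) := by
  obtain ⟨α, β, h⟩ := exists_thetaHess_eq h0 h1
  have hsq : ∀ x : ℂ, x ≠ 0 → theta x q ^ 2 =
      thetaEven q x * thetaOdd q 1 - thetaOdd q x * thetaEven q 1 := by
    intro x hx
    have := mul_theta_mul_theta h0 h1 hx one_ne_zero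
    rw [mul_one, div_one, one_mul] at this
    rw [sq, this]
  refine ⟨-(α * thetaEven q 1 + β * thetaOdd q 1), fun x y hx hy => ?_⟩
  rw [mul_theta_mul_theta h0 h1 hx hy, hsq x hx, hsq y hy, h x hx, h y hy]
  ring

/-! ### The Weierstrass function attached to `theta` -/

/-- The regular part `(q; q)_∞ (q x; q)_∞ (q / x; q)_∞` of the theta function. -/
noncomputable def thetaReg (q x : ℂ) : ℂ :=
  eulerE q * (qPochhammerInf (x * q) q * qPochhammerInf (q / x) q)

/-- Removing the zero at `x = 1` leaves a factor whose logarithm has a Laurent expansion on an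
annulus containing the unit circle. -/
lemma theta_eq_thetaReg {q x : ℂ} (h0 : q ≠ 0) (h1 : ‖q‖ < 1) (hx : x ≠ 0) :
    theta x q = (1 - x) * thetaReg q x := by
  rw [theta_eq_prod h0 h1 hx, qPochhammerInf_eq_mul x h1, thetaReg]
  ring

/-- The Lambert series `∑_{k ∈ ℤ} |k| q^{|k|} / (1 - q^{|k|}) x^k`. -/
noncomputable def lambertSum (q x : ℂ) : ℂ :=
  ∑' k : ℤ, k.natAbs * q ^ k.natAbs / (1 - q ^ k.natAbs) * x ^ k

lemma isOpen_logAnnulus (q : ℂ) : IsOpen (logAnnulus q) := isOpen_Ioo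

/-- Away from zeros of `θ`, `thetaHess / θ²` is `-D² log θ`, and the factor `1 - x` contributes `x /
(1 - x)²`. Clearing the denominators keeps the formula valid at `x = 1`, where it is needed to find
the constant `K`. -/
lemma thetaHess_exp {q : ℂ} (h0 : q ≠ 0) (h1 : ‖q‖ < 1) {z : ℂ} (hz : z.re ∈ logAnnulus q) :
    thetaHess q (Complex.exp z) = thetaReg q (Complex.exp z) ^ 2 *
      (Complex.exp z + (1 - Complex.exp z) ^ 2 *
        laurentSum (fun n => n * (n * logCoeff q n)) z) := by
  have hopen : IsOpen {w : ℂ | w.re ∈ logAnnulus q} :=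
    (isOpen_logAnnulus q).preimage Complex.continuous_re
  have hs := laurentSummable_logCoeff h0 h1
  have hs1 := hs.mul (isOpen_logAnnulus q)
  set S0 := laurentSum (logCoeff q) with hS0
  set S1 := laurentSum (fun n => n * logCoeff q n) with hS1
  set S2 := laurentSum (fun n => n * (n * logCoeff q n)) with hS2
  have hg : ∀ w : ℂ, w.re ∈ logAnnulus q →
      thetaReg q (Complex.exp w) = eulerE q * Complex.exp (-S0 w) := by
    intro w hw
    rw [thetaReg, qPochhammerInf_mul_eq_exp h0 h1 hw]
  have d0 : ∀ w : ℂ, w.re ∈ logAnnulus q → HasDerivAt S0 (S1 w) w := fun w hw =>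
    hs.hasDerivAt (isOpen_logAnnulus q) hw
  have d1 : ∀ w : ℂ, w.re ∈ logAnnulus q → HasDerivAt S1 (S2 w) w := fun w hw =>
    hs1.hasDerivAt (isOpen_logAnnulus q) hw
  have dg : ∀ w : ℂ, w.re ∈ logAnnulus q →
      HasDerivAt (fun w => eulerE q * Complex.exp (-S0 w))
        (-(eulerE q * Complex.exp (-S0 w)) * S1 w) w := fun w hw =>
    ((d0 w hw).neg.cexp.const_mul (eulerE q)).congr_deriv (by simp only [Pi.neg_apply]; ring)
  have m0 : ∀ w : ℂ, w.re ∈ logAnnulus q → thetaMoment q 0 (Complex.exp w) =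
      (1 - Complex.exp w) * (eulerE q * Complex.exp (-S0 w)) := by
    intro w hw
    rw [thetaMoment_zero, theta_eq_thetaReg h0 h1 (Complex.exp_ne_zero w), hg w hw]
  have m1 : ∀ w : ℂ, w.re ∈ logAnnulus q → thetaMoment q 1 (Complex.exp w) =
      (eulerE q * Complex.exp (-S0 w)) * (-Complex.exp w - (1 - Complex.exp w) * S1 w) := by
    intro w hw
    have a := hasDerivAt_thetaMoment h0 h1 0 w
    have b := ((Complex.hasDerivAt_exp w).const_sub 1).mul (dg w hw)
    have c := a.congr_of_eventuallyEq (f₁ := fun w =>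
      (1 - Complex.exp w) * (eulerE q * Complex.exp (-S0 w)))
      (by filter_upwards [hopen.mem_nhds hw] with v hv using (m0 v hv).symm)
    rw [c.unique b]
    ring
  have m2 : thetaMoment q 2 (Complex.exp z) = (eulerE q * Complex.exp (-S0 z)) *
      (-Complex.exp z + 2 * Complex.exp z * S1 z +
        (1 - Complex.exp z) * (S1 z ^ 2 - S2 z)) := by
    have a := hasDerivAt_thetaMoment h0 h1 1 z
    have b := (dg z hz).mul ((Complex.hasDerivAt_exp z).neg.sub
      (((Complex.hasDerivAt_exp z).const_sub 1).mul (d1 z hz)))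
    have c := a.congr_of_eventuallyEq (f₁ := fun w => (eulerE q * Complex.exp (-S0 w)) *
      (-Complex.exp w - (1 - Complex.exp w) * S1 w))
      (by filter_upwards [hopen.mem_nhds hz] with v hv using (m1 v hv).symm)
    rw [c.unique b]
    simp only [Pi.sub_apply, Pi.mul_apply, Pi.neg_apply]
    ring
  rw [thetaHess, m0 z hz, m1 z hz, m2, hg z hz]
  ring

lemma thetaHess_eq {q x : ℂ} (h0 : q ≠ 0) (h1 : ‖q‖ < 1) (hx1 : ‖q‖ < ‖x‖)
    (hx2 : ‖q‖ * ‖x‖ < 1) :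
    thetaHess q x = thetaReg q x ^ 2 * (x + (1 - x) ^ 2 * lambertSum q x) := by
  have hqpos : 0 < ‖q‖ := norm_pos_iff.mpr h0
  have hxpos : 0 < ‖x‖ := hqpos.trans hx1
  have hx : x ≠ 0 := norm_pos_iff.mp hxpos
  have hz : (Complex.log x).re ∈ logAnnulus q := by
    rw [Complex.log_re]
    refine ⟨Real.log_lt_log hqpos hx1, ?_⟩
    have := Real.log_neg (mul_pos hqpos hxpos) hx2
    rw [Real.log_mul hqpos.ne' hxpos.ne'] at this
    linarith
  have key := thetaHess_exp h0 h1 hz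
  rw [Complex.exp_log hx] at key
  have e : laurentSum (fun n => n * (n * logCoeff q n)) (Complex.log x) = lambertSum q x := by
    refine tsum_congr fun k => ?_
    simp only [Complex.exp_int_mul, Complex.exp_log hx, logCoeff]
    congr 1
    have hk : (k : ℂ) * k = (k.natAbs : ℂ) * k.natAbs := by
      rw [← Int.cast_mul, ← Int.natAbs_mul_self' k, Int.cast_mul, Int.cast_natCast]
    rcases eq_or_ne k.natAbs 0 with h | h
    · have : k = 0 := Int.natAbs_eq_zero.mp h
      simp [this]
    · have h2 : (k.natAbs : ℂ) ≠ 0 := Nat.cast_ne_zero.mpr h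
      have h3 := one_sub_pow_ne_zero h1 h
      rw [← mul_assoc, hk]
      field_simp
  rw [key, e]

lemma theta_one {q : ℂ} (h0 : q ≠ 0) (h1 : ‖q‖ < 1) : theta 1 q = 0 := by
  rw [theta_eq_thetaReg h0 h1 one_ne_zero, sub_self, zero_mul]

lemma thetaHess_mul_sub {q x y : ℂ} (h0 : q ≠ 0) (h1 : ‖q‖ < 1) (hx : x ≠ 0) (hy : y ≠ 0) :
    thetaHess q x * theta y q ^ 2 - thetaHess q y * theta x q ^ 2 =
      -eulerE q ^ 6 * (y * (theta (x * y) q * theta (x / y) q)) := by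
  obtain ⟨K, hK⟩ := exists_thetaHess_mul_sub h0 h1
  have hm : (-1 : ℂ) ≠ 0 := by norm_num
  -- Since `θ(1) = 0` and `θ(-1) ≠ 0`, this choice gives `K = -thetaHess q 1`.
  have h := hK (-1) 1 hm one_ne_zero
  have hθ : theta (-1) q ≠ 0 := by
    rw [theta_eq_thetaReg h0 h1 hm, thetaReg]
    have hq : ‖-q‖ < 1 := by rwa [norm_neg]
    have e1 : -1 * q = -q := by ring
    have e2 : q / -1 = -q := by ring
    rw [e1, e2]
    have := qPochhammerInf_ne_zero_of_norm_lt h1 hq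
    have := eulerE_ne_zero h1
    norm_num
    tauto
  have hh : thetaHess q 1 = eulerE q ^ 6 := by
    rw [thetaHess_eq h0 h1 (by simpa using h1) (by simpa using h1), thetaReg, one_mul, div_one,
      ← eulerE]
    ring
  rw [theta_one h0 h1, mul_one, div_one, hh] at h
  have hK' : K = -eulerE q ^ 6 := by
    have h2 : theta (-1) q ^ 2 * (K + eulerE q ^ 6) = 0 := by linear_combination -h
    have := (mul_eq_zero.mp h2).resolve_left (pow_ne_zero 2 hθ)
    linear_combination this
  rw [hK x y hx hy, hK']

/-! ### Lambert series -/

lemma theta_div_self {q x : ℂ} (h0 : q ≠ 0) (h1 : ‖q‖ < 1) (hx : x ≠ 0) :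
    theta (q / x) q = theta x q := by
  rw [theta_eq_prod h0 h1 hx, theta_eq_prod h0 h1 (div_ne_zero h0 hx), div_div_cancel₀ h0,
    mul_comm (qPochhammerInf x q)]

lemma theta_inv {q x : ℂ} (h0 : q ≠ 0) (h1 : ‖q‖ < 1) (hx : x ≠ 0) :
    theta x⁻¹ q = -x⁻¹ * theta x q := by
  rw [theta_eq_thetaReg h0 h1 hx, theta_eq_thetaReg h0 h1 (inv_ne_zero hx), thetaReg, thetaReg,
    div_inv_eq_mul, mul_comm q x, inv_mul_eq_div]
  field_simp
  ring

lemma thetaReg_ne_zero {q x : ℂ} (h1 : ‖q‖ < 1) (hx1 : ‖q‖ < ‖x‖) (hx2 : ‖q‖ * ‖x‖ < 1) :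
    thetaReg q x ≠ 0 := by
  have hx : 0 < ‖x‖ := (norm_nonneg q).trans_lt hx1
  refine mul_ne_zero (eulerE_ne_zero h1) (mul_ne_zero ?_ ?_)
  · exact qPochhammerInf_ne_zero_of_norm_lt h1 (by rwa [norm_mul, mul_comm])
  · exact qPochhammerInf_ne_zero_of_norm_lt h1 (by rwa [norm_div, div_lt_one hx])

/-- The formula for `℘(u) - ℘(v)` in multiplicative coordinates: `x / (1 - x)² + lambertSum q x`
plays the role of `℘`, up to normalisation, and `theta` that of `σ`. -/
lemma weierstrass_sub {q x y : ℂ} (h0 : q ≠ 0) (h1 : ‖q‖ < 1) (hx1 : ‖q‖ < ‖x‖)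
    (hx2 : ‖q‖ * ‖x‖ < 1) (hx : x ≠ 1) (hy1 : ‖q‖ < ‖y‖) (hy2 : ‖q‖ * ‖y‖ < 1) (hy : y ≠ 1) :
    (x / (1 - x) ^ 2 + lambertSum q x) - (y / (1 - y) ^ 2 + lambertSum q y) =
      -eulerE q ^ 6 * (y * (theta (x * y) q * theta (x / y) q)) /
        (theta x q * theta y q) ^ 2 := by
  have hx0 : x ≠ 0 := norm_pos_iff.mp ((norm_nonneg q).trans_lt hx1)
  have hy0 : y ≠ 0 := norm_pos_iff.mp ((norm_nonneg q).trans_lt hy1)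
  have rx := thetaReg_ne_zero h1 hx1 hx2
  have ry := thetaReg_ne_zero h1 hy1 hy2
  have hx' : 1 - x ≠ 0 := sub_ne_zero.mpr hx.symm
  have hy' : 1 - y ≠ 0 := sub_ne_zero.mpr hy.symm
  rw [← thetaHess_mul_sub h0 h1 hx0 hy0, thetaHess_eq h0 h1 hx1 hx2, thetaHess_eq h0 h1 hy1 hy2,
    theta_eq_thetaReg h0 h1 hx0, theta_eq_thetaReg h0 h1 hy0]
  field_simp

lemma hasSum_pnat_iff_nat {f : ℕ → ℂ} (hf : f 0 = 0) {a : ℂ} :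
    HasSum (fun n : ℕ+ => f n) a ↔ HasSum f a :=
  Function.Injective.hasSum_iff (f := f) PNat.coe_injective fun n hn => by
    rcases Nat.eq_zero_or_pos n with rfl | h
    · exact hf
    · exact absurd ⟨⟨n, h⟩, rfl⟩ hn

lemma hasSum_lambertSum {q x : ℂ} (h0 : q ≠ 0) (h1 : ‖q‖ < 1) (hx1 : ‖q‖ < ‖x‖)
    (hx2 : ‖q‖ * ‖x‖ < 1) :
    HasSum (fun k : ℕ+ => (k : ℂ) * q ^ (k : ℕ) / (1 - q ^ (k : ℕ)) *
      (x ^ (k : ℕ) + (x⁻¹) ^ (k : ℕ))) (lambertSum q x) := by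
  have hs : Summable fun k : ℤ => (k.natAbs * q ^ k.natAbs / (1 - q ^ k.natAbs) * x ^ k : ℂ) := by
    have hq := norm_pos_iff.mpr h0
    have key : ∀ y : ℂ, ‖q‖ * ‖y‖ < 1 →
        Summable fun n : ℕ => ((n : ℂ) * q ^ n / (1 - q ^ n) * y ^ n) := by
      intro y hy
      have h2 : ‖q * y‖ < 1 := by rwa [norm_mul]
      refine Summable.of_norm_bounded
        (g := fun n : ℕ => (1 - ‖q‖)⁻¹ * ‖(n : ℂ) ^ 1 * (q * y) ^ n‖)
        ((summable_norm_pow_mul_geometric_of_norm_lt_one 1 h2).mul_left _) fun n => ?_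
      rcases Nat.eq_zero_or_pos n with rfl | hn
      · simp
      · have h3 := norm_one_sub_pow_ge h1 hn.ne'
        have h4 : 0 < 1 - ‖q‖ := by linarith
        rw [pow_one, mul_pow, norm_mul, norm_div, ← mul_assoc, norm_mul _ (y ^ n),
          ← mul_assoc, inv_mul_eq_div]
        gcongr
    have hx : 0 < ‖x‖ := hq.trans hx1
    refine Summable.of_nat_of_neg ?_ ?_
    · simpa using key x hx2
    · have := key x⁻¹ (by rwa [norm_inv, ← div_eq_mul_inv, div_lt_one hx])
      simpa using this
  have := hs.hasSum.nat_add_neg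
  simp only [Int.natAbs_neg, Int.natAbs_natCast, zpow_neg, zpow_natCast, ← mul_add,
    ← inv_pow] at this
  rw [← hasSum_pnat_iff_nat (by simp)] at this
  simpa [lambertSum] using this

/-- The quadratic character modulo `5`, as a function on the natural numbers. -/
def chiFive (n : ℕ) : ℤ :=
  if n % 5 = 1 ∨ n % 5 = 4 then 1 else if n % 5 = 2 ∨ n % 5 = 3 then -1 else 0

lemma chiFive_mod (n : ℕ) : chiFive (n % 5) = chiFive n := by
  simp [chiFive]

lemma norm_chiFive_le (n : ℕ) : ‖(chiFive n : ℂ)‖ ≤ 1 := by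
  unfold chiFive
  split_ifs <;> simp

/-- The absolutely convergent double series over `(k, m)` is regrouped by the product `n = k m`. -/
lemma hasSum_divisors {f g : ℕ → ℂ} (hf : ∀ n, ‖f n‖ ≤ n) (hg : ∀ n, ‖g n‖ ≤ 1) {q : ℂ}
    (h1 : ‖q‖ < 1) :
    HasSum (fun n : ℕ+ => (∑ p ∈ (n : ℕ).divisorsAntidiagonal, f p.1 * g p.2) * q ^ (n : ℕ))
      (∑' k : ℕ+, f k * ∑' m : ℕ+, g m * (q ^ (k : ℕ)) ^ (m : ℕ)) := by
  have hs : Summable fun c : ℕ+ × ℕ+ => f c.1 * (g c.2 * (q ^ (c.1 : ℕ)) ^ (c.2 : ℕ)) := by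
    have h := (Equiv.prodComm ℕ+ ℕ+).summable_iff.mpr
      (summable_prod_mul_pow (𝕜 := ℝ) 1 (r := ‖q‖) (by simpa using h1))
    refine Summable.of_norm_bounded h ?_
    rintro ⟨k, m⟩
    simp only [Function.comp_apply, Equiv.prodComm_apply, Prod.swap_prod_mk, pow_one]
    rw [norm_mul, norm_mul, ← pow_mul, norm_pow, mul_comm (m : ℕ)]
    calc ‖f k‖ * (‖g m‖ * ‖q‖ ^ ((k : ℕ) * m)) ≤ k * (1 * ‖q‖ ^ ((k : ℕ) * m)) := by
          gcongr
          · exact hf k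
          · exact hg m
      _ = _ := by rw [one_mul]
  have e : ∑' c : ℕ+ × ℕ+, f c.1 * (g c.2 * (q ^ (c.1 : ℕ)) ^ (c.2 : ℕ)) =
      ∑' k : ℕ+, f k * ∑' m : ℕ+, g m * (q ^ (k : ℕ)) ^ (m : ℕ) := by
    rw [hs.tsum_prod]
    simp only [tsum_mul_left]
  rw [← e]
  refine (sigmaAntidiagonalEquivProd.hasSum_iff.mpr hs.hasSum).sigma fun n => ?_
  have e2 : ∀ c : (n : ℕ).divisorsAntidiagonal,
      f c.1.1 * (g c.1.2 * (q ^ c.1.1) ^ c.1.2) = f c.1.1 * g c.1.2 * q ^ (n : ℕ) := fun c => by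
    rw [← pow_mul, (Nat.mem_divisorsAntidiagonal.mp c.2).1, mul_assoc]
  rw [Finset.sum_mul, ← Finset.sum_attach, ← Finset.univ_eq_attach,
    ← Finset.sum_congr rfl fun c _ => e2 c]
  exact hasSum_fintype _

lemma tsum_chiFive_mul_pow {x : ℂ} (hx : ‖x‖ < 1) :
    ∑' m : ℕ+, (chiFive m : ℂ) * x ^ (m : ℕ) =
      (x - x ^ 2 - x ^ 3 + x ^ 4) / (1 - x ^ 5) := by
  have hs : Summable fun m : ℕ => (chiFive m : ℂ) * x ^ m := by
    refine Summable.of_norm_bounded (summable_geometric_of_lt_one (norm_nonneg x) hx) fun m => ?_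
    rw [norm_mul, norm_pow]
    exact mul_le_of_le_one_left (by positivity) (norm_chiFive_le m)
  have h := hs.sum_add_tsum_nat_add 5
  have h2 : ∑' m : ℕ, (chiFive (m + 5) : ℂ) * x ^ (m + 5) =
      x ^ 5 * ∑' m : ℕ, (chiFive m : ℂ) * x ^ m := by
    rw [← tsum_mul_left]
    refine tsum_congr fun m => ?_
    rw [← chiFive_mod (m + 5), Nat.add_mod_right, chiFive_mod]
    ring
  have h5 := one_sub_pow_ne_zero hx (k := 5) (by norm_num)
  rw [((hasSum_pnat_iff_nat (by simp [chiFive])).mpr hs.hasSum).tsum_eq, eq_div_iff h5]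
  rw [h2] at h
  simp only [Finset.sum_range_succ, Finset.sum_range_zero, show chiFive 0 = 0 from rfl,
    show chiFive 1 = 1 from rfl, show chiFive 2 = -1 from rfl, show chiFive 3 = -1 from rfl,
    show chiFive 4 = 1 from rfl] at h
  push_cast at h
  linear_combination -h

/-- `∑_{d ∣ n} χ(n / d) d`. -/
def sigmaQuot (n : ℕ) : ℤ := ∑ p ∈ n.divisorsAntidiagonal, (p.1 : ℤ) * chiFive p.2

/-- `∑_{d ∣ n} χ(d) d`. -/
def sigmaTwist (n : ℕ) : ℤ := ∑ p ∈ n.divisorsAntidiagonal, chiFive p.1 * (p.1 : ℤ)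

lemma norm_lt_of_pow {q : ℂ} (h0 : q ≠ 0) (h1 : ‖q‖ < 1) {m n : ℕ} (h : m < n) :
    ‖q ^ n‖ < ‖q ^ m‖ := by
  rw [norm_pow, norm_pow]
  exact pow_lt_pow_right_of_lt_one₀ (norm_pos_iff.mpr h0) h1 h

lemma ne_one_of_norm_lt {x : ℂ} (h : ‖x‖ < 1) : x ≠ 1 := by
  rintro rfl
  simp at h

/-- The Lambert series for `q E⁵(q⁵) / E(q)`. -/
lemma hasSum_sigmaQuot_of_ne_zero {q : ℂ} (h0 : q ≠ 0) (h1 : ‖q‖ < 1) :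
    HasSum (fun n : ℕ+ => (sigmaQuot n : ℂ) * q ^ (n : ℕ))
      (q * (eulerE (q ^ 5) ^ 5 / eulerE q)) := by
  have hE1 := eulerE_ne_zero h1
  have hE5 := eulerE_pow_ne_zero h1 (k := 5) (by norm_num)
  have n1 : ‖q ^ 5‖ < 1 := norm_pow_lt_one h1 (by norm_num)
  have n2 : ‖q ^ 2‖ < 1 := norm_pow_lt_one h1 (by norm_num)
  have q5 : q ^ 5 ≠ 0 := pow_ne_zero 5 h0
  have q2 : q ^ 2 ≠ 0 := pow_ne_zero 2 h0
  have a1 : ‖q ^ 5‖ < ‖q‖ := by simpa using norm_lt_of_pow h0 h1 (m := 1) (n := 5) (by norm_num)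
  have a2 : ‖q ^ 5‖ < ‖q ^ 2‖ := norm_lt_of_pow h0 h1 (by norm_num)
  have b1 : ‖q ^ 5‖ * ‖q‖ < 1 := mul_lt_one_of_nonneg_of_lt_one_left (norm_nonneg _) n1 h1.le
  have b2 : ‖q ^ 5‖ * ‖q ^ 2‖ < 1 := mul_lt_one_of_nonneg_of_lt_one_left (norm_nonneg _) n1 n2.le
  -- For `x = q`, `y = q²` in base `q⁵`, the values at `x y = q³` and `x / y = q⁻¹` are again those
  -- at `q²` and `q` up to elementary factors. The quotient collapses to `1 / (θ(q) θ(q²))`, whose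
  -- denominator covers all residues modulo `5`.
  have W := weierstrass_sub q5 n1 a1 b1 (ne_one_of_norm_lt h1) a2 b2 (ne_one_of_norm_lt n2)
  have t3 : theta (q * q ^ 2) (q ^ 5) = theta (q ^ 2) (q ^ 5) := by
    rw [← theta_div_self q5 n1 q2]
    congr 1
    field_simp
  have t1 : theta (q / q ^ 2) (q ^ 5) = -q⁻¹ * theta q (q ^ 5) := by
    rw [← theta_inv q5 n1 h0]
    congr 1
    field_simp
  have tt : theta q (q ^ 5) * theta (q ^ 2) (q ^ 5) = eulerE (q ^ 5) * eulerE q := by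
    have d := qPochhammerInf_dissect q h1 5
    simp only [Fin.prod_univ_five] at d
    norm_num [← pow_mul] at d
    rw [theta_eq_prod q5 n1 h0, theta_eq_prod q5 n1 q2]
    have e1 : q ^ 5 / q = q ^ 4 := by field_simp
    have e2 : q ^ 5 / q ^ 2 = q ^ 3 := by field_simp
    rw [e1, e2, eulerE.eq_def q, d, show q * q = q ^ 2 by ring, show q * q ^ 2 = q ^ 3 by ring,
      show q * q ^ 3 = q ^ 4 by ring, show q * q ^ 4 = q ^ 5 by ring, ← eulerE]
    ring
  have W2 : (q / (1 - q) ^ 2 + lambertSum (q ^ 5) q) -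
      (q ^ 2 / (1 - q ^ 2) ^ 2 + lambertSum (q ^ 5) (q ^ 2)) =
      q * (eulerE (q ^ 5) ^ 5 / eulerE q) := by
    have ne : theta q (q ^ 5) * theta (q ^ 2) (q ^ 5) ≠ 0 := by
      rw [tt]; exact mul_ne_zero hE5 hE1
    rw [W, t3, t1]
    have : -eulerE (q ^ 5) ^ 6 * (q ^ 2 * (theta (q ^ 2) (q ^ 5) * (-q⁻¹ * theta q (q ^ 5)))) /
        (theta q (q ^ 5) * theta (q ^ 2) (q ^ 5)) ^ 2 =
        q * eulerE (q ^ 5) ^ 6 / (theta q (q ^ 5) * theta (q ^ 2) (q ^ 5)) := by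
      have := left_ne_zero_of_mul ne
      have := right_ne_zero_of_mul ne
      field_simp
    rw [this, tt]
    field_simp
  have g : ∀ y : ℂ, ‖y‖ < 1 → HasSum (fun k : ℕ+ => (k : ℂ) * y ^ (k : ℕ)) (y / (1 - y) ^ 2) :=
    fun y hy => (hasSum_pnat_iff_nat (f := fun k : ℕ => (k : ℂ) * y ^ k) (by simp)).mpr
      (hasSum_coe_mul_geometric_of_norm_lt_one hy)
  have S := ((g q h1).add (hasSum_lambertSum q5 n1 a1 b1)).sub
    ((g _ n2).add (hasSum_lambertSum q5 n1 a2 b2))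
  rw [W2] at S
  have L := hasSum_divisors (f := fun n => (n : ℂ)) (g := fun n => (chiFive n : ℂ))
    (fun n => by simp) norm_chiFive_le h1
  -- Termwise, with `x = q ^ k`: `x + x⁵ (x + x⁻¹) / (1 - x⁵) = (x + x⁴) / (1 - x⁵)`. Subtracting
  -- the analogue for `x²` gives the generating function of `χ`.
  have e : ∑' k : ℕ+, (k : ℂ) * ∑' m : ℕ+, (chiFive m : ℂ) * (q ^ (k : ℕ)) ^ (m : ℕ) =
      q * (eulerE (q ^ 5) ^ 5 / eulerE q) := by
    rw [← S.tsum_eq]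
    refine tsum_congr fun k => ?_
    have hk : ‖q ^ (k : ℕ)‖ < 1 := norm_pow_lt_one h1 k.ne_zero
    have hp : ∀ m : ℕ, (q ^ m) ^ (k : ℕ) = (q ^ (k : ℕ)) ^ m := fun m => by
      rw [← pow_mul, mul_comm, pow_mul]
    rw [tsum_chiFive_mul_pow hk, inv_pow, inv_pow, hp 5, hp 2]
    have hx0 : q ^ (k : ℕ) ≠ 0 := pow_ne_zero _ h0
    have h5 := one_sub_pow_ne_zero hk (k := 5) (by norm_num)
    generalize q ^ (k : ℕ) = x at *
    field_simp
    ring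
  rw [e] at L
  refine L.congr_fun fun n => ?_
  simp [sigmaQuot]

lemma tsum_pnat_pow {x : ℂ} (hx : ‖x‖ < 1) : ∑' m : ℕ+, x ^ (m : ℕ) = x / (1 - x) := by
  rw [tsum_pnat_eq_tsum_succ (f := fun m => x ^ m)]
  simp only [pow_succ', tsum_mul_left, tsum_geometric_of_norm_lt_one hx, div_eq_mul_inv]

lemma gauss_sum_five {ζ : ℂ} (hζ : 1 + ζ + ζ ^ 2 + ζ ^ 3 + ζ ^ 4 = 0) (k : ℕ) :
    ζ ^ k + (ζ ^ 4) ^ k - ((ζ ^ 2) ^ k + (ζ ^ 3) ^ k) =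
      chiFive k * (ζ - ζ ^ 2 - ζ ^ 3 + ζ ^ 4) := by
  have h5 : ζ ^ 5 = 1 := by linear_combination (ζ - 1) * hζ
  have hmod : ∀ x : ℂ, x ^ 5 = 1 → x ^ k = x ^ (k % 5) := by
    intro x hx
    conv_lhs => rw [← Nat.div_add_mod k 5, pow_add, pow_mul, hx, one_pow, one_mul]
  have hpow : ∀ m : ℕ, (ζ ^ m) ^ 5 = 1 := fun m => by
    rw [← pow_mul, mul_comm, pow_mul, h5, one_pow]
  rw [hmod ζ h5, hmod _ (hpow 4), hmod _ (hpow 2), hmod _ (hpow 3), ← chiFive_mod k]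
  have hk := Nat.mod_lt k (show 0 < 5 by norm_num)
  interval_cases k % 5 <;> simp [chiFive] <;> grind

lemma gauss_sum_five_sq {ζ : ℂ} (hζ : 1 + ζ + ζ ^ 2 + ζ ^ 3 + ζ ^ 4 = 0) :
    (ζ - ζ ^ 2 - ζ ^ 3 + ζ ^ 4) ^ 2 = 5 := by
  grind

lemma gauss_sum_five_mul {ζ : ℂ} (hζ : 1 + ζ + ζ ^ 2 + ζ ^ 3 + ζ ^ 4 = 0) :
    (ζ - ζ ^ 2 - ζ ^ 3 + ζ ^ 4) * ((1 - ζ) * (1 - ζ ^ 2)) = 5 * ζ ^ 4 := by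
  grind

lemma gauss_sum_five_diff {ζ : ℂ} (hζ : 1 + ζ + ζ ^ 2 + ζ ^ 3 + ζ ^ 4 = 0) :
    5 * (ζ * (1 - ζ ^ 2) ^ 2 - ζ ^ 2 * (1 - ζ) ^ 2) =
      -(ζ - ζ ^ 2 - ζ ^ 3 + ζ ^ 4) * ((1 - ζ) ^ 2 * (1 - ζ ^ 2) ^ 2) := by
  grind

/-- The Lambert series for `E⁵(q) / E(q⁵)`. -/
lemma hasSum_sigmaTwist_of_ne_zero {q : ℂ} (h0 : q ≠ 0) (h1 : ‖q‖ < 1) :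
    HasSum (fun n : ℕ+ => (sigmaTwist n : ℂ) * q ^ (n : ℕ))
      ((1 - eulerE q ^ 5 / eulerE (q ^ 5)) / 5) := by
  have hE1 := eulerE_ne_zero h1
  have hE5 := eulerE_pow_ne_zero h1 (k := 5) (by norm_num)
  obtain ⟨ζ, hprim⟩ : ∃ ζ : ℂ, IsPrimitiveRoot ζ 5 := ⟨_, Complex.isPrimitiveRoot_exp 5 (by norm_num)⟩
  have hζ : 1 + ζ + ζ ^ 2 + ζ ^ 3 + ζ ^ 4 = 0 := by
    have := hprim.geom_sum_eq_zero (by norm_num)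
    simpa [Finset.sum_range_succ] using this
  have h5 : ζ ^ 5 = 1 := hprim.pow_eq_one
  have hn : ‖ζ‖ = 1 := hprim.norm'_eq_one (by norm_num)
  have hn2 : ‖ζ ^ 2‖ = 1 := by rw [norm_pow, hn, one_pow]
  have z0 : ζ ≠ 0 := hprim.ne_zero (by norm_num)
  have z1 : ζ ≠ 1 := hprim.ne_one (by norm_num)
  have z2 : ζ ^ 2 ≠ 1 := hprim.pow_ne_one_of_pos_of_lt (by norm_num) (by norm_num)
  have zz : ζ ^ 2 ≠ 0 := pow_ne_zero 2 z0
  have i1 : ζ⁻¹ = ζ ^ 4 := inv_eq_of_mul_eq_one_right (by linear_combination h5)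
  have i2 : (ζ ^ 2)⁻¹ = ζ ^ 3 := inv_eq_of_mul_eq_one_right (by linear_combination h5)
  have a1 : ‖q‖ < ‖ζ‖ := by rwa [hn]
  have a2 : ‖q‖ < ‖ζ ^ 2‖ := by rwa [hn2]
  have b1 : ‖q‖ * ‖ζ‖ < 1 := by rwa [hn, mul_one]
  have b2 : ‖q‖ * ‖ζ ^ 2‖ < 1 := by rwa [hn2, mul_one]
  obtain ⟨G, hG⟩ : ∃ G, G = ζ - ζ ^ 2 - ζ ^ 3 + ζ ^ 4 := ⟨_, rfl⟩
  have hG2 : G ^ 2 = 5 := by rw [hG, gauss_sum_five_sq hζ]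
  have hG0 : G ≠ 0 := by rintro rfl; norm_num at hG2
  -- Here `x y = ζ³ = (ζ²)⁻¹` and `x / y = ζ⁻¹`, so the quotient collapses again. Now `θ(ζ) θ(ζ²)`
  -- runs over all nontrivial fifth roots of unity.
  have W := weierstrass_sub h0 h1 a1 b1 z1 a2 b2 z2
  have t3 : theta (ζ * ζ ^ 2) q = -(ζ ^ 2)⁻¹ * theta (ζ ^ 2) q := by
    rw [← theta_inv h0 h1 zz, i2]; ring_nf
  have t1 : theta (ζ / ζ ^ 2) q = -ζ⁻¹ * theta ζ q := by
    rw [← theta_inv h0 h1 z0]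
    congr 1
    field_simp
  have z1' : 1 - ζ ≠ 0 := sub_ne_zero.mpr z1.symm
  have z2' : 1 - ζ ^ 2 ≠ 0 := sub_ne_zero.mpr z2.symm
  have tt : theta ζ q * theta (ζ ^ 2) q =
      (1 - ζ) * (1 - ζ ^ 2) * (eulerE q * eulerE (q ^ 5)) := by
    have d := qPochhammerInf_mul_roots hζ q h1
    rw [← eulerE, ← eulerE] at d
    rw [theta_eq_thetaReg h0 h1 z0, theta_eq_thetaReg h0 h1 zz, thetaReg, thetaReg,
      div_eq_mul_inv q ζ, div_eq_mul_inv q (ζ ^ 2), i1, i2, ← d, mul_comm q (ζ ^ 4),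
      mul_comm q (ζ ^ 3)]
    ring
  have W2 : (ζ / (1 - ζ) ^ 2 + lambertSum q ζ) -
      (ζ ^ 2 / (1 - ζ ^ 2) ^ 2 + lambertSum q (ζ ^ 2)) =
      -(eulerE q ^ 5 / eulerE (q ^ 5)) * (G / 5) := by
    have ne : theta ζ q * theta (ζ ^ 2) q ≠ 0 := by
      rw [tt]; exact mul_ne_zero (mul_ne_zero z1' z2') (mul_ne_zero hE1 hE5)
    have h4 : G * ((1 - ζ) * (1 - ζ ^ 2)) = 5 * ζ⁻¹ := by
      rw [hG, i1, gauss_sum_five_mul hζ]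
    have hG5 : G / 5 = ζ⁻¹ / ((1 - ζ) * (1 - ζ ^ 2)) := by
      rw [div_eq_div_iff (by norm_num) (mul_ne_zero z1' z2'), h4, mul_comm]
    rw [W, t3, t1, hG5]
    have : -eulerE q ^ 6 * (ζ ^ 2 * (-(ζ ^ 2)⁻¹ * theta (ζ ^ 2) q * (-ζ⁻¹ * theta ζ q))) /
        (theta ζ q * theta (ζ ^ 2) q) ^ 2 =
        -eulerE q ^ 6 * ζ⁻¹ / (theta ζ q * theta (ζ ^ 2) q) := by
      have := left_ne_zero_of_mul ne
      have := right_ne_zero_of_mul ne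
      field_simp
    rw [this, tt]
    field_simp
  -- This difference of principal parts accounts for the `1` in `1 - E⁵(q) / E(q⁵)`. Dividing by the
  -- Gauss sum `G` then leaves `χ(k)` as coefficient.
  have c0 : ζ / (1 - ζ) ^ 2 - ζ ^ 2 / (1 - ζ ^ 2) ^ 2 = -(G / 5) := by
    rw [hG, div_sub_div _ _ (pow_ne_zero 2 z1') (pow_ne_zero 2 z2'),
      div_eq_iff (mul_ne_zero (pow_ne_zero 2 z1') (pow_ne_zero 2 z2'))]
    linear_combination gauss_sum_five_diff hζ / 5
  have S := ((hasSum_lambertSum h0 h1 a1 b1).sub (hasSum_lambertSum h0 h1 a2 b2)).mul_left G⁻¹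
  have hval : G⁻¹ * (lambertSum q ζ - lambertSum q (ζ ^ 2)) =
      (1 - eulerE q ^ 5 / eulerE (q ^ 5)) / 5 := by
    rw [show lambertSum q ζ - lambertSum q (ζ ^ 2) =
      (1 - eulerE q ^ 5 / eulerE (q ^ 5)) * (G / 5) by linear_combination W2 - c0]
    field_simp
  rw [hval] at S
  have L := hasSum_divisors (f := fun n => (chiFive n : ℂ) * n) (g := fun _ => (1 : ℂ))
    (fun n => by
      rw [norm_mul, Complex.norm_natCast]
      exact mul_le_of_le_one_left (Nat.cast_nonneg n) (norm_chiFive_le n)) (by simp) h1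
  have e : ∑' k : ℕ+, (chiFive k : ℂ) * (k : ℕ) * ∑' m : ℕ+, 1 * (q ^ (k : ℕ)) ^ (m : ℕ) =
      (1 - eulerE q ^ 5 / eulerE (q ^ 5)) / 5 := by
    rw [← S.tsum_eq]
    refine tsum_congr fun k => ?_
    have hk : ‖q ^ (k : ℕ)‖ < 1 := norm_pow_lt_one h1 k.ne_zero
    have hg := gauss_sum_five hζ k
    rw [← hG] at hg
    simp only [one_mul]
    rw [tsum_pnat_pow hk, ← mul_sub, i1, i2, hg]
    field_simp
  rw [e] at L
  refine L.congr_fun fun n => ?_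
  simp [sigmaTwist]

/-! ### The arithmetic of the divisor sums -/

lemma chiFive_mul (m n : ℕ) : chiFive (m * n) = chiFive m * chiFive n := by
  rw [← chiFive_mod (m * n), ← chiFive_mod m, ← chiFive_mod n, Nat.mul_mod]
  have hm := Nat.mod_lt m (show 0 < 5 by norm_num)
  have hn := Nat.mod_lt n (show 0 < 5 by norm_num)
  interval_cases m % 5 <;> interval_cases n % 5 <;> rfl

lemma chiFive_pow (m k : ℕ) : chiFive (m ^ k) = chiFive m ^ k := by
  induction k with
  | zero => simp [chiFive]
  | succ k ih => rw [pow_succ, chiFive_mul, ih, pow_succ]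

/-- The quadratic character modulo `5` as an arithmetic function. -/
def chiArith : ArithmeticFunction ℤ := ⟨chiFive, rfl⟩

/-- The identity as an arithmetic function with integer values. -/
def idArith : ArithmeticFunction ℤ := ⟨fun n => n, rfl⟩

lemma isMultiplicative_chiArith : chiArith.IsMultiplicative :=
  ⟨rfl, fun {m n} _ => chiFive_mul m n⟩

lemma isMultiplicative_idArith : idArith.IsMultiplicative :=
  ⟨rfl, fun {m n} _ => Nat.cast_mul m n⟩

lemma sigmaTwist_eq (n : ℕ) :
    sigmaTwist n = (chiArith.pmul idArith * (ArithmeticFunction.zeta : ArithmeticFunction ℤ)) n := by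
  rw [ArithmeticFunction.coe_mul_zeta_apply, sigmaTwist,
    Nat.sum_divisorsAntidiagonal (fun i _ => chiFive i * (i : ℤ))]
  rfl

lemma sigmaQuot_eq_prod {n : ℕ} (hn : n ≠ 0) :
    sigmaQuot n = ∏ p ∈ n.primeFactors, sigmaQuot (p ^ n.factorization p) :=
  ArithmeticFunction.IsMultiplicative.multiplicative_factorization _
    (isMultiplicative_idArith.mul isMultiplicative_chiArith) hn

lemma sigmaTwist_eq_prod {n : ℕ} (hn : n ≠ 0) :
    sigmaTwist n = ∏ p ∈ n.primeFactors, sigmaTwist (p ^ n.factorization p) := by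
  simp only [sigmaTwist_eq]
  exact ArithmeticFunction.IsMultiplicative.multiplicative_factorization _
    ((isMultiplicative_chiArith.pmul isMultiplicative_idArith).mul
      ArithmeticFunction.isMultiplicative_zeta.natCast) hn

lemma sigmaTwist_prime_pow {p : ℕ} (hp : p.Prime) (v : ℕ) :
    sigmaTwist (p ^ v) = ∑ i ∈ Finset.range (v + 1), (chiFive p * p) ^ i := by
  rw [sigmaTwist, Nat.sum_divisorsAntidiagonal (fun i _ => chiFive i * (i : ℤ)),
    Nat.sum_divisors_prime_pow hp]
  refine Finset.sum_congr rfl fun i _ => ?_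
  rw [chiFive_pow, Nat.cast_pow, mul_pow]

lemma sigmaQuot_prime_pow {p : ℕ} (hp : p.Prime) (v : ℕ) :
    sigmaQuot (p ^ v) = ∑ i ∈ Finset.range (v + 1), (p : ℤ) ^ i * chiFive p ^ (v - i) := by
  rw [sigmaQuot, Nat.sum_divisorsAntidiagonal (fun i j => (i : ℤ) * chiFive j),
    Nat.sum_divisors_prime_pow hp]
  refine Finset.sum_congr rfl fun i hi => ?_
  rw [Nat.pow_div (by simpa [Nat.lt_succ_iff] using hi) hp.pos, chiFive_pow, Nat.cast_pow]

/-- As `χ(p) = ±1`, one has `χ(p)^{v-i} = χ(p)^v χ(p)^i`. These signs, over `2` and the odd primes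
`±2` modulo `5`, build `(-1)^{g+t}`. -/
lemma sigmaQuot_prime_pow_eq {p : ℕ} (hp : p.Prime) (hχ : chiFive p ^ 2 = 1) (v : ℕ) :
    sigmaQuot (p ^ v) = chiFive p ^ v * sigmaTwist (p ^ v) := by
  rw [sigmaQuot_prime_pow hp, sigmaTwist_prime_pow hp, Finset.mul_sum]
  refine Finset.sum_congr rfl fun i hi => ?_
  have hiv : i ≤ v := by simpa [Nat.lt_succ_iff] using hi
  obtain ⟨j, rfl⟩ := Nat.exists_eq_add_of_le hiv
  have : chiFive p ^ i * chiFive p ^ i = 1 := by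
    rw [← pow_add, ← two_mul, pow_mul, hχ, one_pow]
  rw [Nat.add_sub_cancel_left, mul_pow, pow_add]
  linear_combination (-chiFive p ^ j * (p : ℤ) ^ i) * this

lemma sigmaQuot_five_pow (v : ℕ) : sigmaQuot (5 ^ v) = 5 ^ v := by
  rw [sigmaQuot_prime_pow Nat.prime_five, Finset.sum_range_succ,
    Finset.sum_eq_zero fun i hi => ?_]
  · simp
  · have : chiFive 5 = 0 := rfl
    rw [this, zero_pow (by have := Finset.mem_range.mp hi; omega), mul_zero]

lemma sigmaTwist_five_pow (v : ℕ) : sigmaTwist (5 ^ v) = 1 := by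
  have : chiFive 5 = 0 := rfl
  rw [sigmaTwist_prime_pow Nat.prime_five, this, zero_mul, Finset.sum_range_succ',
    Finset.sum_eq_zero fun i _ => zero_pow (Nat.succ_ne_zero i)]
  simp

lemma sigmaTwist_two_pow (v : ℕ) : (sigmaTwist (2 ^ v) : ℂ) = (1 - (-2) ^ (v + 1)) / 3 := by
  have h : chiFive 2 = -1 := rfl
  rw [sigmaTwist_prime_pow Nat.prime_two, h]
  push_cast
  rw [geom_sum_eq (by norm_num)]
  norm_num
  ring

lemma chiFive_of_mem_primesOne {n p : ℕ} (hp : p ∈ primesOne n) : chiFive p = 1 :=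
  if_pos (Finset.mem_filter.mp hp).2

lemma chiFive_of_mem_primesTwo {n p : ℕ} (hp : p ∈ primesTwo n) : chiFive p = -1 := by
  have h := (Finset.mem_filter.mp hp).2.2
  unfold chiFive
  rw [if_neg (by omega), if_pos h]

lemma prime_of_mem_primesOne {n p : ℕ} (hp : p ∈ primesOne n) : p.Prime :=
  Nat.prime_of_mem_primeFactors (Finset.mem_filter.mp hp).1

lemma prime_of_mem_primesTwo {n p : ℕ} (hp : p ∈ primesTwo n) : p.Prime :=
  Nat.prime_of_mem_primeFactors (Finset.mem_filter.mp hp).1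

lemma prod_primeFactors_eq {M : Type*} [CommMonoid M] (n : ℕ) (f : ℕ → ℕ → M)
    (hf : ∀ p, f p 0 = 1) :
    ∏ p ∈ n.primeFactors, f p (n.factorization p) =
      f 2 (n.factorization 2) * f 5 (n.factorization 5) *
        ((∏ p ∈ primesOne n, f p (n.factorization p)) *
          ∏ p ∈ primesTwo n, f p (n.factorization p)) := by
  have hd : Disjoint (primesOne n) (primesTwo n) := by
    rw [Finset.disjoint_left]
    intro p h1 h2
    have e1 := (Finset.mem_filter.mp h1).2
    have e2 := (Finset.mem_filter.mp h2).2
    omega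
  have h5 : 5 ∉ primesOne n ∪ primesTwo n := by
    simp [primesOne, primesTwo]
  have h2 : 2 ∉ insert 5 (primesOne n ∪ primesTwo n) := by
    simp [primesOne, primesTwo]
  rw [← Finset.prod_union hd, mul_assoc, 
    ← Finset.prod_insert (f := fun p => f p (n.factorization p)) h5,
    ← Finset.prod_insert (f := fun p => f p (n.factorization p)) h2]
  -- The primes `2` and `5` may fail to divide `n`; their factors are then `f p 0 = 1`.
  refine Finset.prod_subset (fun p hp => ?_) fun p _ hp => ?_
  · have hprime := Nat.prime_of_mem_primeFactors hp
    have h0 : p % 5 = 0 → p = 5 := fun h =>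
      ((Nat.prime_dvd_prime_iff_eq Nat.prime_five hprime).mp (Nat.dvd_of_mod_eq_zero h)).symm
    simp only [Finset.mem_insert, Finset.mem_union, primesOne, primesTwo, Finset.mem_filter, hp,
      true_and]
    by_cases hp2 : p = 2
    · exact Or.inl hp2
    · by_cases hp5 : p % 5 = 0
      · exact Or.inr (Or.inl (h0 hp5))
      · omega
  · rw [← Nat.support_factorization, Finsupp.notMem_support_iff] at hp
    rw [hp, hf]

lemma sigmaTwist_one : sigmaTwist 1 = 1 := rfl

lemma sigmaQuot_one : sigmaQuot 1 = 1 := rfl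

lemma prod_sigmaTwist_eq_primesProd (n : ℕ) :
    (∏ p ∈ primesOne n, (sigmaTwist (p ^ n.factorization p) : ℂ)) *
      ∏ p ∈ primesTwo n, (sigmaTwist (p ^ n.factorization p) : ℂ) = primesProd n := by
  rw [primesProd]
  congr 1
  · refine Finset.prod_congr rfl fun p hp => ?_
    have hprime := prime_of_mem_primesOne hp
    have h1 : (p : ℂ) ≠ 1 := by exact_mod_cast hprime.one_lt.ne'
    rw [sigmaTwist_prime_pow hprime, chiFive_of_mem_primesOne hp]
    push_cast
    rw [one_mul, geom_sum_eq h1, ← neg_div_neg_eq, neg_sub, neg_sub]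
  · refine Finset.prod_congr rfl fun p hp => ?_
    have hprime := prime_of_mem_primesTwo hp
    have h1 : (-1 * (p : ℂ)) ≠ 1 := by
      intro h
      have h2 : (p : ℂ) + 1 = 0 := by linear_combination -h
      norm_cast at h2
    rw [sigmaTwist_prime_pow hprime, chiFive_of_mem_primesTwo hp]
    push_cast
    rw [geom_sum_eq h1, neg_one_mul, ← neg_div_neg_eq]
    ring_nf

/-- The values of `∑_{d ∣ n} χ(d) d`. -/
lemma sigmaTwist_eq_primesProd {n : ℕ} (hn : n ≠ 0) :
    (sigmaTwist n : ℂ) = (1 - (-2) ^ (n.factorization 2 + 1)) / 3 * primesProd n := by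
  rw [sigmaTwist_eq_prod hn, prod_primeFactors_eq n (fun p v => sigmaTwist (p ^ v))
    (fun p => by rw [pow_zero, sigmaTwist_one])]
  push_cast
  rw [prod_sigmaTwist_eq_primesProd, sigmaTwist_two_pow, sigmaTwist_five_pow]
  simp

/-- The values of `∑_{d ∣ n} χ(n / d) d`. -/
lemma sigmaQuot_eq_primesProd {n : ℕ} (hn : n ≠ 0) :
    (sigmaQuot n : ℂ) = 5 ^ n.factorization 5 * (-1) ^ (n.factorization 2 + primesTwoOmega n) *
      ((1 - (-2) ^ (n.factorization 2 + 1)) / 3 * primesProd n) := by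
  rw [sigmaQuot_eq_prod hn, prod_primeFactors_eq n (fun p v => sigmaQuot (p ^ v))
    (fun p => by rw [pow_zero, sigmaQuot_one])]
  have e1 : ∏ p ∈ primesOne n, sigmaQuot (p ^ n.factorization p) =
      ∏ p ∈ primesOne n, sigmaTwist (p ^ n.factorization p) :=
    Finset.prod_congr rfl fun p hp => by
      have hχ := chiFive_of_mem_primesOne hp
      rw [sigmaQuot_prime_pow_eq (prime_of_mem_primesOne hp) (by rw [hχ]; rfl), hχ, one_pow,
        one_mul]
  have e2 : ∏ p ∈ primesTwo n, sigmaQuot (p ^ n.factorization p) =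
      (-1) ^ primesTwoOmega n * ∏ p ∈ primesTwo n, sigmaTwist (p ^ n.factorization p) := by
    rw [primesTwoOmega, ← Finset.prod_pow_eq_pow_sum, ← Finset.prod_mul_distrib]
    refine Finset.prod_congr rfl fun p hp => ?_
    have hχ := chiFive_of_mem_primesTwo hp
    rw [sigmaQuot_prime_pow_eq (prime_of_mem_primesTwo hp) (by rw [hχ]; rfl), hχ]
  have h2 : chiFive 2 = -1 := rfl
  rw [e1, e2, sigmaQuot_five_pow, sigmaQuot_prime_pow_eq Nat.prime_two rfl, h2]
  push_cast
  rw [← prod_sigmaTwist_eq_primesProd, sigmaTwist_two_pow, pow_add]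
  ring

lemma primeFactors_two_mul_filter {m : ℕ} (hm : m ≠ 0) (P : ℕ → Prop) [DecidablePred P]
    (hP : ¬P 2) : (2 * m).primeFactors.filter P = m.primeFactors.filter P := by
  rw [Nat.primeFactors_mul two_ne_zero hm, Nat.prime_two.primeFactors, Finset.filter_union]
  simp [Finset.filter_singleton, hP]

lemma factorization_two_mul {m : ℕ} (hm : m ≠ 0) {p : ℕ} (hp : p ≠ 2) :
    (2 * m).factorization p = m.factorization p := by
  rw [Nat.factorization_mul two_ne_zero hm, Finsupp.add_apply, Nat.prime_two.factorization,
    Finsupp.single_eq_of_ne hp, zero_add]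

lemma factorization_two_mul_self {m : ℕ} (hm : m ≠ 0) :
    (2 * m).factorization 2 = m.factorization 2 + 1 := by
  rw [Nat.factorization_mul two_ne_zero hm, Finsupp.add_apply, Nat.prime_two.factorization,
    Finsupp.single_eq_same, add_comm]

lemma primesOne_two_mul {m : ℕ} (hm : m ≠ 0) : primesOne (2 * m) = primesOne m :=
  primeFactors_two_mul_filter hm _ (by norm_num)

lemma primesTwo_two_mul {m : ℕ} (hm : m ≠ 0) : primesTwo (2 * m) = primesTwo m :=
  primeFactors_two_mul_filter hm _ (by norm_num)

lemma primesTwoOmega_two_mul {m : ℕ} (hm : m ≠ 0) :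
    primesTwoOmega (2 * m) = primesTwoOmega m := by
  rw [primesTwoOmega, primesTwo_two_mul hm]
  exact Finset.sum_congr rfl fun p hp =>
    factorization_two_mul hm (Finset.mem_filter.mp hp).2.1

lemma primesProd_two_mul {m : ℕ} (hm : m ≠ 0) : primesProd (2 * m) = primesProd m := by
  rw [primesProd, primesOne_two_mul hm, primesTwo_two_mul hm, primesProd]
  congr 1
  · refine Finset.prod_congr rfl fun p hp => ?_
    have : p ≠ 2 := by
      rintro rfl
      simp [primesOne] at hp
    rw [factorization_two_mul hm this]
  · refine Finset.prod_congr rfl fun p hp => ?_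
    rw [factorization_two_mul hm (Finset.mem_filter.mp hp).2.1]

/-- The coefficients of `f(q²)`, for a power series `f` with the given coefficients. -/
def halfCoeff (f : ℕ → ℤ) (n : ℕ) : ℤ := if 2 ∣ n then f (n / 2) else 0

/-- For even `n`, `(1 - (-2)^{g+1}) + 4 (1 - (-2)^g) = 5 + (-2)^{g+1}`. For odd `n` both local
factors at `2` equal `1`. -/
lemma sigmaTwist_add_half {n : ℕ} (hn : n ≠ 0) :
    (sigmaTwist n + 4 * halfCoeff sigmaTwist n : ℂ) =
      (5 + (-2) ^ (n.factorization 2 + 1)) / 3 * primesProd n := by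
  rw [sigmaTwist_eq_primesProd hn, halfCoeff]
  split_ifs with h
  · obtain ⟨m, rfl⟩ := h
    have hm : m ≠ 0 := by rintro rfl; exact hn rfl
    rw [Nat.mul_div_cancel_left m two_pos, sigmaTwist_eq_primesProd hm, primesProd_two_mul hm,
      factorization_two_mul_self hm]
    ring
  · rw [Nat.factorization_eq_zero_of_not_dvd h]
    norm_num

/-- Halving `n` flips `(-1)^{g+t}`, so the minus sign turns into the plus of `sigmaTwist_add_half`.
-/
lemma sigmaQuot_sub_half {n : ℕ} (hn : n ≠ 0) :
    (sigmaQuot n - 4 * halfCoeff sigmaQuot n : ℂ) =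
      5 ^ n.factorization 5 * (-1) ^ (n.factorization 2 + primesTwoOmega n) *
      ((5 + (-2) ^ (n.factorization 2 + 1)) / 3 * primesProd n) := by
  rw [sigmaQuot_eq_primesProd hn, halfCoeff]
  split_ifs with h
  · obtain ⟨m, rfl⟩ := h
    have hm : m ≠ 0 := by rintro rfl; exact hn rfl
    rw [Nat.mul_div_cancel_left m two_pos, sigmaQuot_eq_primesProd hm, primesProd_two_mul hm,
      factorization_two_mul_self hm, primesTwoOmega_two_mul hm,
      factorization_two_mul hm (by norm_num : 5 ≠ 2)]
    ring
  · rw [Nat.factorization_eq_zero_of_not_dvd h]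
    norm_num

lemma sigmaTwist_sub_half {n : ℕ} (hn : n ≠ 0) :
    (sigmaTwist n - halfCoeff sigmaTwist n : ℂ) =
      (-2) ^ n.factorization 2 * primesProd n := by
  rw [sigmaTwist_eq_primesProd hn, halfCoeff]
  split_ifs with h
  · obtain ⟨m, rfl⟩ := h
    have hm : m ≠ 0 := by rintro rfl; exact hn rfl
    rw [Nat.mul_div_cancel_left m two_pos, sigmaTwist_eq_primesProd hm, primesProd_two_mul hm,
      factorization_two_mul_self hm]
    ring
  · rw [Nat.factorization_eq_zero_of_not_dvd h]
    norm_num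

lemma sigmaQuot_add_half {n : ℕ} (hn : n ≠ 0) :
    (sigmaQuot n + halfCoeff sigmaQuot n : ℂ) =
      5 ^ n.factorization 5 * (-1) ^ (n.factorization 2 + primesTwoOmega n) *
      ((-2) ^ n.factorization 2 * primesProd n) := by
  rw [sigmaQuot_eq_primesProd hn, halfCoeff]
  split_ifs with h
  · obtain ⟨m, rfl⟩ := h
    have hm : m ≠ 0 := by rintro rfl; exact hn rfl
    rw [Nat.mul_div_cancel_left m two_pos, sigmaQuot_eq_primesProd hm, primesProd_two_mul hm,
      factorization_two_mul_self hm, primesTwoOmega_two_mul hm,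
      factorization_two_mul hm (by norm_num : 5 ≠ 2)]
    ring
  · rw [Nat.factorization_eq_zero_of_not_dvd h]
    norm_num

/-! ### Counting representations -/

lemma hasSum_mul_prod {β γ : Type*} {f : β → ℂ} {g : γ → ℂ} {a b : ℂ} (hf : HasSum f a)
    (hg : HasSum g b) : HasSum (fun p : β × γ => f p.1 * g p.2) (a * b) := by
  have hf' := summable_norm_iff.mpr hf.summable
  have hg' := summable_norm_iff.mpr hg.summable
  rw [← hf.tsum_eq, ← hg.tsum_eq, tsum_mul_tsum_of_summable_norm hf' hg']
  exact (summable_mul_of_summable_norm hf' hg').hasSum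

lemma hasSum_ncard {β : Type*} (N : β → ℕ) {q S : ℂ} (h0 : q ≠ 0)
    (h : HasSum (fun b => q ^ N b) S) :
    HasSum (fun n : ℕ => ({b | N b = n}.ncard : ℂ) * q ^ n) S := by
  refine ((Equiv.sigmaFiberEquiv N).hasSum_iff.mpr h).sigma fun n => ?_
  have e : (fun c : {b // N b = n} => ((fun b => q ^ N b) ∘ Equiv.sigmaFiberEquiv N) ⟨n, c⟩) =
      fun _ => q ^ n := by
    ext c
    simp [c.2]
  rw [e]
  -- An infinite fibre would make a nonzero constant summable over an infinite set. Finiteness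
  -- ensures that `ncard` is a true count and not its default value `0`.
  have hfin : Finite {b // N b = n} := by
    by_contra hinf
    rw [not_finite_iff_infinite] at hinf
    have hs : Summable fun _ : {b // N b = n} => q ^ n := by
      rw [← e]
      exact ((Equiv.sigmaFiberEquiv N).summable_iff.mpr h.summable).sigma_factor n
    exact pow_ne_zero n h0 (tendsto_nhds_unique tendsto_const_nhds hs.tendsto_cofinite_zero)
  have := Fintype.ofFinite {b // N b = n}
  have hc : {b | N b = n}.ncard = Fintype.card {b // N b = n} := by
    rw [← Nat.card_eq_fintype_card]; rfl
  have hs := hasSum_fintype fun _ : {b // N b = n} => q ^ n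
  rwa [Finset.sum_const, Finset.card_univ, nsmul_eq_mul, ← hc] at hs

lemma hasSum_ramanujanPhi {q : ℂ} (h0 : q ≠ 0) (h1 : ‖q‖ < 1) :
    HasSum (fun n : ℤ => q ^ n.natAbs ^ 2) (ramanujanPhi q) := by
  rw [ramanujanPhi_eq_thetaPow h0]
  refine (summable_norm_thetaPow h0 h1 two_ne_zero 1).of_norm.hasSum.congr_fun fun n => ?_
  rw [← zpow_natCast]
  congr 1
  have := two_mul_tri n
  push_cast
  rw [sq_abs]
  linarith

/-- The bilateral series `thetaPow q 1 1` equals `2 ψ(q)` by the product formulas; folding it by `k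
↔ -(k + 1)` meets each triangular number twice. -/
lemma hasSum_ramanujanPsi {q : ℂ} (h0 : q ≠ 0) (h1 : ‖q‖ < 1) :
    HasSum (fun k : ℕ => q ^ (k * (k + 1) / 2)) (ramanujanPsi q) := by
  have h := (summable_norm_thetaPow h0 h1 one_ne_zero 1).of_norm.hasSum.nat_add_neg_add_one
  have h2 := h.mul_left (1 / 2)
  have e : ramanujanPsi q = 1 / 2 * thetaPow q 1 1 := by
    rw [thetaPow_one_one h0 h1, ramanujanPsi_eq_prod h0 h1]; ring
  rw [e]
  refine h2.congr_fun fun k => ?_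
  have ek : ((k * (k + 1) / 2 : ℕ) : ℤ) = tri (k + 1) := by
    rw [tri]
    push_cast
    ring_nf
  have e1 : ((1 : ℕ) : ℤ) * tri k + 1 * k = ((k * (k + 1) / 2 : ℕ) : ℤ) := by
    rw [ek, tri_add_one]; ring
  have e2 : ((1 : ℕ) : ℤ) * tri (-(k + 1)) + 1 * -(k + 1) = ((k * (k + 1) / 2 : ℕ) : ℤ) := by
    rw [ek]
    have t1 := two_mul_tri (-((k : ℤ) + 1))
    have t2 := two_mul_tri ((k : ℤ) + 1)
    push_cast
    linarith
  rw [e1, e2, zpow_natCast]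
  ring

lemma quaternaryCount_eq (k l n : ℕ) :
    quaternaryCount k l n = {v : ℤ × ℤ × ℤ × ℤ | k * v.1.natAbs ^ 2 + l *
      (v.2.1.natAbs ^ 2 + v.2.2.1.natAbs ^ 2 + v.2.2.2.natAbs ^ 2) = n}.ncard := by
  unfold quaternaryCount
  congr 1
  ext v
  simp only [Set.mem_ofPred_eq]
  rw [← Int.natCast_inj]
  push_cast
  simp only [sq_abs]

lemma hasSum_quaternaryCount {q : ℂ} (h0 : q ≠ 0) (h1 : ‖q‖ < 1) {k l : ℕ} (hk : k ≠ 0)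
    (hl : l ≠ 0) :
    HasSum (fun n : ℕ+ => (quaternaryCount k l n : ℂ) * q ^ (n : ℕ))
      (ramanujanPhi (q ^ k) * ramanujanPhi (q ^ l) ^ 3 - 1) := by
  have hK := hasSum_ramanujanPhi (pow_ne_zero k h0) (norm_pow_lt_one h1 hk)
  have hL := hasSum_ramanujanPhi (pow_ne_zero l h0) (norm_pow_lt_one h1 hl)
  have hP := hasSum_mul_prod hK (hasSum_mul_prod hL (hasSum_mul_prod hL hL))
  have hN := hasSum_ncard (fun v : ℤ × ℤ × ℤ × ℤ => k * v.1.natAbs ^ 2 + l *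
      (v.2.1.natAbs ^ 2 + v.2.2.1.natAbs ^ 2 + v.2.2.2.natAbs ^ 2)) h0
      (hP.congr_fun fun v => by rw [pow_add, pow_mul, pow_mul, pow_add, pow_add]; ring)
  simp only [← quaternaryCount_eq] at hN
  have hz : quaternaryCount k l (0 : ℕ) = 1 := by
    rw [quaternaryCount_eq, Set.ncard_eq_one]
    refine ⟨0, ?_⟩
    ext ⟨x, y, z, w⟩
    simp [hk, hl, and_assoc]
  have hv : ramanujanPhi (q ^ k) * ramanujanPhi (q ^ l) ^ 3 - 1 +
      (quaternaryCount k l (0 : ℕ) : ℂ) * q ^ 0 = ramanujanPhi (q ^ k) *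
        (ramanujanPhi (q ^ l) * (ramanujanPhi (q ^ l) * ramanujanPhi (q ^ l))) := by
    rw [hz, Nat.cast_one]
    ring
  rw [hasSum_pnat_iff (f := fun n : ℕ => (quaternaryCount k l n : ℂ) * q ^ n), hv]
  exact hN

lemma triangular_injective : Function.Injective fun k : ℕ => k * (k + 1) / 2 := by
  refine StrictMono.injective (strictMono_nat_of_lt_succ fun k => ?_)
  have : (k + 1) * (k + 1 + 1) = k * (k + 1) + 2 * (k + 1) := by ring
  rw [this, Nat.add_mul_div_left _ _ two_pos]
  omega

lemma triangularCount_eq (k l s n : ℕ) :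
    triangularCount k l s n = {v : ℕ × ℕ × ℕ × ℕ | k * (v.1 * (v.1 + 1) / 2) + l *
      (v.2.1 * (v.2.1 + 1) / 2 + v.2.2.1 * (v.2.2.1 + 1) / 2 +
        v.2.2.2 * (v.2.2.2 + 1) / 2) + s = n}.ncard := by
  have hi := triangular_injective
  rw [← Set.ncard_image_of_injective _ (hi.prodMap (hi.prodMap (hi.prodMap hi)))]
  unfold triangularCount
  congr 1
  ext ⟨x, y, z, w⟩
  simp only [Set.mem_ofPred_eq, Set.mem_image, Prod.exists, Prod.map_apply, Prod.mk.injEq,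
    IsTriangularNumber]
  constructor
  · rintro ⟨⟨a, rfl⟩, ⟨b, rfl⟩, ⟨c, rfl⟩, ⟨d, rfl⟩, h⟩
    exact ⟨a, b, c, d, h, rfl, rfl, rfl, rfl⟩
  · rintro ⟨a, b, c, d, h, rfl, rfl, rfl, rfl⟩
    exact ⟨⟨a, rfl⟩, ⟨b, rfl⟩, ⟨c, rfl⟩, ⟨d, rfl⟩, h⟩

lemma hasSum_triangularCount {q : ℂ} (h0 : q ≠ 0) (h1 : ‖q‖ < 1) {k l s : ℕ} (hk : k ≠ 0)
    (hl : l ≠ 0) (hs : s ≠ 0) :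
    HasSum (fun n : ℕ+ => (triangularCount k l s n : ℂ) * q ^ (n : ℕ))
      (q ^ s * (ramanujanPsi (q ^ k) * ramanujanPsi (q ^ l) ^ 3)) := by
  have hK := hasSum_ramanujanPsi (pow_ne_zero k h0) (norm_pow_lt_one h1 hk)
  have hL := hasSum_ramanujanPsi (pow_ne_zero l h0) (norm_pow_lt_one h1 hl)
  have hP := (hasSum_mul_prod hK (hasSum_mul_prod hL (hasSum_mul_prod hL hL))).mul_left (q ^ s)
  have hN := hasSum_ncard (fun v : ℕ × ℕ × ℕ × ℕ => k * (v.1 * (v.1 + 1) / 2) + l *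
      (v.2.1 * (v.2.1 + 1) / 2 + v.2.2.1 * (v.2.2.1 + 1) / 2 +
        v.2.2.2 * (v.2.2.2 + 1) / 2) + s) h0
      (hP.congr_fun fun v => by
        rw [pow_add, pow_add, pow_mul, pow_mul, pow_add, pow_add]; ring)
  simp only [← triangularCount_eq] at hN
  have hz : triangularCount k l s 0 = 0 := by
    rw [triangularCount_eq]
    simp [hs]
  rw [hasSum_pnat_iff_nat (f := fun n : ℕ => (triangularCount k l s n : ℂ) * q ^ n)
    (by simp [hz])]
  convert hN using 1
  ring

/-! ### Power series expansions -/

lemma hasSum_zero_pow (c : ℕ+ → ℂ) : HasSum (fun n : ℕ+ => c n * 0 ^ (n : ℕ)) 0 := by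
  simp

lemma ramanujanF_zero : ramanujanF 0 0 = 1 := by
  rw [ramanujanF, tsum_eq_single 0]
  · simp
  · intro n hn
    have h1 : n * (n + 1) / 2 = tri n + n := by
      rw [← tri_add_one, tri]; ring_nf
    rw [h1, ← tri]
    have h := two_mul_tri n
    -- The exponents `tri n` and `tri n + n` vanish together only at `n = 0`.
    by_cases ht : tri n = 0
    · rw [ht, zero_add, zero_zpow n hn, zero_mul]
    · rw [zero_zpow _ ht, mul_zero]

lemma ramanujanPhi_zero : ramanujanPhi 0 = 1 := ramanujanF_zero

/-- Uniqueness of power series coefficients. The expansion with coefficients `b` is required only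
for `q ≠ 0`, where the product formulas apply; at `q = 0` series without constant term vanish
anyway. -/
lemma eq_of_hasSum_pow {a b : ℕ+ → ℂ} {F : ℂ → ℂ}
    (ha : ∀ q : ℂ, ‖q‖ < 1 → HasSum (fun n : ℕ+ => a n * q ^ (n : ℕ)) (F q))
    (hb : ∀ q : ℂ, q ≠ 0 → ‖q‖ < 1 → HasSum (fun n : ℕ+ => b n * q ^ (n : ℕ)) (F q)) (n : ℕ+) :
    a n = b n := by
  set c : ℕ → ℂ := fun n => if h : 0 < n then a ⟨n, h⟩ - b ⟨n, h⟩ else 0 with hc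
  have hsum : ∀ q : ℂ, ‖q‖ < 1 → HasSum (fun n : ℕ => c n * q ^ n) 0 := by
    intro q hq
    rw [← hasSum_pnat_iff_nat (f := fun n => c n * q ^ n) (by simp [hc])]
    have e : ∀ n : ℕ+, c n = a n - b n := fun n => dif_pos n.pos
    simp only [e]
    rcases eq_or_ne q 0 with rfl | h0
    · exact hasSum_zero_pow _
    · have := (ha q hq).sub (hb q h0 hq)
      rw [sub_self] at this
      refine this.congr_fun fun n => by ring
  have hp : HasFPowerSeriesOnBall (fun _ : ℂ => (0 : ℂ)) (FormalMultilinearSeries.ofScalars ℂ c)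
      0 (1 / 2 : NNReal) := by
    refine ⟨?_, by norm_num, fun {y} hy => ?_⟩
    · refine FormalMultilinearSeries.le_radius_of_summable _ ?_
      have := (hsum (1 / 2) (by norm_num)).summable.norm
      refine this.congr fun n => ?_
      simp
    · have hy' : ‖y‖ < 1 := by
        have h2 : y ∈ Metric.ball (0 : ℂ) (1 / 2 : NNReal) := by
          rwa [← Metric.eball_coe]
        rw [mem_ball_zero_iff] at h2
        refine h2.trans ?_
        norm_num
      refine (hsum y hy').congr_fun fun n => ?_
      simp [mul_comm]
  have h0 := hp.hasFPowerSeriesAt.eq_zero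
  have hcn : c n = 0 := by
    rw [← FormalMultilinearSeries.coeff_ofScalars (𝕜 := ℂ) (p := c) (n := n), h0]
    rfl
  have : c n = a n - b n := dif_pos n.pos
  exact sub_eq_zero.mp (this ▸ hcn)

lemma hasSum_halfCoeff {f : ℕ → ℤ} {q S : ℂ}
    (h : HasSum (fun n : ℕ+ => (f n : ℂ) * (q ^ 2) ^ (n : ℕ)) S) :
    HasSum (fun n : ℕ+ => (halfCoeff f n : ℂ) * q ^ (n : ℕ)) S := by
  have hi : Function.Injective fun n : ℕ+ => 2 * n := mul_right_injective 2
  refine (hi.hasSum_iff fun n hn => ?_).mp (h.congr_fun fun n => ?_)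
  · rw [halfCoeff, if_neg, Int.cast_zero, zero_mul]
    rintro ⟨m, hm⟩
    have hm0 : 0 < m := Nat.pos_of_ne_zero (by rintro rfl; simp at hm)
    exact hn ⟨⟨m, hm0⟩, PNat.eq hm.symm⟩
  · simp [halfCoeff, pow_mul]

/-- The coefficients of `φ(-q) φ³(-q⁵)` and `φ³(-q) φ(-q⁵)`. -/
lemma hasSum_phi_combination {q : ℂ} (h0 : q ≠ 0) (h1 : ‖q‖ < 1) (r : ℂ) :
    HasSum (fun n : ℕ+ => -((1 + r * 5 ^ (n : ℕ).factorization 5 *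
        (-1) ^ ((n : ℕ).factorization 2 + primesTwoOmega n)) *
        ((5 + (-2) ^ ((n : ℕ).factorization 2 + 1)) / 3) * primesProd n) * q ^ (n : ℕ))
      ((eulerE q ^ 5 / eulerE (q ^ 5) + 4 * (eulerE (q ^ 2) ^ 5 / eulerE (q ^ 10))) / 5
          - r * (q * (eulerE (q ^ 5) ^ 5 / eulerE q)
              - 4 * q ^ 2 * (eulerE (q ^ 10) ^ 5 / eulerE (q ^ 2))) - 1) := by
  have q2 := pow_ne_zero 2 h0
  have n2 := norm_pow_lt_one h1 two_ne_zero
  have A := hasSum_sigmaTwist_of_ne_zero h0 h1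
  have B := hasSum_halfCoeff (hasSum_sigmaTwist_of_ne_zero q2 n2)
  have C := hasSum_sigmaQuot_of_ne_zero h0 h1
  have D := hasSum_halfCoeff (hasSum_sigmaQuot_of_ne_zero q2 n2)
  -- The constants in `A` and `4 B` add up to `(1 + 4) / 5 = 1`, the constant term that is
  -- subtracted.
  have S := ((A.add (B.mul_left 4)).neg).sub ((C.sub (D.mul_left 4)).mul_left r)
  rw [← pow_mul] at S
  norm_num only at S
  refine (congrArg₂ (fun f s => HasSum f s) (funext fun n => ?_) ?_).mpr S
  · have e1 := sigmaTwist_add_half n.ne_zero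
    have e2 := sigmaQuot_sub_half n.ne_zero
    linear_combination (q ^ (n : ℕ)) * e1 + (r * q ^ (n : ℕ)) * e2
  · ring

/-- The coefficients of `4 q ψ³(q) ψ(q⁵)` and `4 q² ψ(q) ψ³(q⁵)`. -/
lemma hasSum_psi_combination {q : ℂ} (h0 : q ≠ 0) (h1 : ‖q‖ < 1) (r : ℂ) :
    HasSum (fun n : ℕ+ => ((-2) ^ (n : ℕ).factorization 2 *
        (-1 + r * 5 ^ (n : ℕ).factorization 5 *
          (-1) ^ ((n : ℕ).factorization 2 + primesTwoOmega n)) * primesProd n) * q ^ (n : ℕ))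
      ((eulerE q ^ 5 / eulerE (q ^ 5) - eulerE (q ^ 2) ^ 5 / eulerE (q ^ 10)) / 5
          + r * (q * (eulerE (q ^ 5) ^ 5 / eulerE q)
              + q ^ 2 * (eulerE (q ^ 10) ^ 5 / eulerE (q ^ 2)))) := by
  have q2 := pow_ne_zero 2 h0
  have n2 := norm_pow_lt_one h1 two_ne_zero
  have A := hasSum_sigmaTwist_of_ne_zero h0 h1
  have B := hasSum_halfCoeff (hasSum_sigmaTwist_of_ne_zero q2 n2)
  have C := hasSum_sigmaQuot_of_ne_zero h0 h1
  have D := hasSum_halfCoeff (hasSum_sigmaQuot_of_ne_zero q2 n2)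
  have S := (B.sub A).add ((C.add D).mul_left r)
  rw [← pow_mul] at S
  norm_num only at S
  refine (congrArg₂ (fun f s => HasSum f s) (funext fun n => ?_) ?_).mpr S
  · have e1 := sigmaTwist_sub_half n.ne_zero
    have e2 := sigmaQuot_add_half n.ne_zero
    linear_combination (q ^ (n : ℕ)) * e1 - (r * q ^ (n : ℕ)) * e2
  · ring

lemma neg_one_pow_pred_mul (n : ℕ+) (x q : ℂ) :
    (-1) ^ ((n : ℕ) - 1) * x * q ^ (n : ℕ) = -x * (-q) ^ (n : ℕ) := by
  obtain ⟨m, hm⟩ : ∃ m, (n : ℕ) = m + 1 := ⟨n - 1, (Nat.succ_pred_eq_of_pos n.pos).symm⟩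
  rw [hm, Nat.add_sub_cancel, neg_pow q, pow_succ]
  ring

end

theorem theorem7p1 :
    -- the four theta function identities
    (∀ q : ℂ, ‖q‖ < 1 →
      ramanujanPhi (-q) * ramanujanPhi (-q ^ 5) ^ 3 =
          (eulerE q ^ 5 / eulerE (q ^ 5) + 4 * (eulerE (q ^ 2) ^ 5 / eulerE (q ^ 10))) / 5
          - (q * (eulerE (q ^ 5) ^ 5 / eulerE q)
              - 4 * q ^ 2 * (eulerE (q ^ 10) ^ 5 / eulerE (q ^ 2))) ∧
      ramanujanPhi (-q) ^ 3 * ramanujanPhi (-q ^ 5) =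
          (eulerE q ^ 5 / eulerE (q ^ 5) + 4 * (eulerE (q ^ 2) ^ 5 / eulerE (q ^ 10))) / 5
          - 5 * (q * (eulerE (q ^ 5) ^ 5 / eulerE q)
              - 4 * q ^ 2 * (eulerE (q ^ 10) ^ 5 / eulerE (q ^ 2))) ∧
      4 * q * ramanujanPsi q ^ 3 * ramanujanPsi (q ^ 5) =
          (eulerE q ^ 5 / eulerE (q ^ 5) - eulerE (q ^ 2) ^ 5 / eulerE (q ^ 10)) / 5
          + 5 * (q * (eulerE (q ^ 5) ^ 5 / eulerE q)
              + q ^ 2 * (eulerE (q ^ 10) ^ 5 / eulerE (q ^ 2))) ∧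
      4 * q ^ 2 * ramanujanPsi q * ramanujanPsi (q ^ 5) ^ 3 =
          (eulerE q ^ 5 / eulerE (q ^ 5) - eulerE (q ^ 2) ^ 5 / eulerE (q ^ 10)) / 5
          + (q * (eulerE (q ^ 5) ^ 5 / eulerE q)
              + q ^ 2 * (eulerE (q ^ 10) ^ 5 / eulerE (q ^ 2)))) ∧
    -- the power series expansions exist, and their coefficients count representations
    (∀ q : ℂ, ‖q‖ < 1 →
      HasSum (fun n : ℕ+ => (quaternaryCount 1 5 n : ℂ) * q ^ (n : ℕ))
        (ramanujanPhi q * ramanujanPhi (q ^ 5) ^ 3 - 1) ∧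
      HasSum (fun n : ℕ+ => (quaternaryCount 5 1 n : ℂ) * q ^ (n : ℕ))
        (ramanujanPhi q ^ 3 * ramanujanPhi (q ^ 5) - 1) ∧
      HasSum (fun n : ℕ+ => 4 * (triangularCount 5 1 1 n : ℂ) * q ^ (n : ℕ))
        (4 * q * ramanujanPsi q ^ 3 * ramanujanPsi (q ^ 5)) ∧
      HasSum (fun n : ℕ+ => 4 * (triangularCount 1 5 2 n : ℂ) * q ^ (n : ℕ))
        (4 * q ^ 2 * ramanujanPsi q * ramanujanPsi (q ^ 5) ^ 3)) ∧
    -- the formulas for the coefficients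
    (∀ a : ℕ+ → ℂ,
      (∀ q : ℂ, ‖q‖ < 1 → HasSum (fun n : ℕ+ => a n * q ^ (n : ℕ))
        (ramanujanPhi q * ramanujanPhi (q ^ 5) ^ 3 - 1)) →
      ∀ n : ℕ+, a n =
        (-1) ^ ((n : ℕ) - 1)
          * (1 + 5 ^ (n : ℕ).factorization 5
              * (-1) ^ ((n : ℕ).factorization 2 + primesTwoOmega n))
          * ((5 + (-2) ^ ((n : ℕ).factorization 2 + 1)) / 3) * primesProd n) ∧
    (∀ b : ℕ+ → ℂ,
      (∀ q : ℂ, ‖q‖ < 1 → HasSum (fun n : ℕ+ => b n * q ^ (n : ℕ))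
        (ramanujanPhi q ^ 3 * ramanujanPhi (q ^ 5) - 1)) →
      ∀ n : ℕ+, b n =
        (-1) ^ ((n : ℕ) - 1)
          * (1 + 5 ^ ((n : ℕ).factorization 5 + 1)
              * (-1) ^ ((n : ℕ).factorization 2 + primesTwoOmega n))
          * ((5 + (-2) ^ ((n : ℕ).factorization 2 + 1)) / 3) * primesProd n) ∧
    (∀ c : ℕ+ → ℂ,
      (∀ q : ℂ, ‖q‖ < 1 → HasSum (fun n : ℕ+ => c n * q ^ (n : ℕ))
        (4 * q * ramanujanPsi q ^ 3 * ramanujanPsi (q ^ 5))) →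
      ∀ n : ℕ+, c n =
        (-2) ^ (n : ℕ).factorization 2
          * (-1 + 5 ^ ((n : ℕ).factorization 5 + 1)
              * (-1) ^ ((n : ℕ).factorization 2 + primesTwoOmega n))
          * primesProd n) ∧
    (∀ d : ℕ+ → ℂ,
      (∀ q : ℂ, ‖q‖ < 1 → HasSum (fun n : ℕ+ => d n * q ^ (n : ℕ))
        (4 * q ^ 2 * ramanujanPsi q * ramanujanPsi (q ^ 5) ^ 3)) →
      ∀ n : ℕ+, d n =
        (-2) ^ (n : ℕ).factorization 2
          * (-1 + 5 ^ (n : ℕ).factorization 5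
              * (-1) ^ ((n : ℕ).factorization 2 + primesTwoOmega n))
          * primesProd n) := by
  refine ⟨fun q h1 => ?_, fun q h1 => ?_, fun a ha => ?_, fun b hb => ?_, fun c hc => ?_,
    fun d hd => ?_⟩
  · rcases eq_or_ne q 0 with rfl | h0
    · norm_num [ramanujanPhi_zero, eulerE_zero]
    · exact theta_identities h0 h1
  · rcases eq_or_ne q 0 with rfl | h0
    · norm_num [ramanujanPhi_zero]
    · refine ⟨?_, ?_, ?_, ?_⟩
      · simpa using hasSum_quaternaryCount h0 h1 one_ne_zero (by norm_num : 5 ≠ 0)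
      · have := hasSum_quaternaryCount h0 h1 (by norm_num : 5 ≠ 0) one_ne_zero
        simpa [mul_comm] using this
      · have := (hasSum_triangularCount h0 h1 (by norm_num : 5 ≠ 0) one_ne_zero
          one_ne_zero).mul_left 4
        rw [pow_one] at this
        refine (congrArg₂ (fun f s => HasSum f s) (funext fun n => ?_) ?_).mpr this
        · ring
        · ring
      · have := (hasSum_triangularCount h0 h1 one_ne_zero (by norm_num : 5 ≠ 0)
          two_ne_zero).mul_left 4
        rw [pow_one] at this
        refine (congrArg₂ (fun f s => HasSum f s) (funext fun n => ?_) ?_).mpr this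
        · ring
        · ring
  · refine eq_of_hasSum_pow ha fun q h0 h1 => ?_
    have hn0 := neg_ne_zero.mpr h0
    have hn1 : ‖-q‖ < 1 := by rwa [norm_neg]
    -- The identity is used at `-q`; returning to `q` produces the sign `(-1)^{n-1}`.
    have h := (theta_identities hn0 hn1).1
    rw [neg_neg, show -(-q) ^ 5 = q ^ 5 by ring] at h
    have S := hasSum_phi_combination hn0 hn1 1
    rw [one_mul, ← h] at S
    refine S.congr_fun fun n => ?_
    rw [one_mul, ← neg_one_pow_pred_mul]
    ring
  · refine eq_of_hasSum_pow hb fun q h0 h1 => ?_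
    have hn0 := neg_ne_zero.mpr h0
    have hn1 : ‖-q‖ < 1 := by rwa [norm_neg]
    have h := (theta_identities hn0 hn1).2.1
    rw [neg_neg, show -(-q) ^ 5 = q ^ 5 by ring] at h
    have S := hasSum_phi_combination hn0 hn1 5
    rw [← h] at S
    refine S.congr_fun fun n => ?_
    rw [← neg_one_pow_pred_mul]
    ring
  · refine eq_of_hasSum_pow hc fun q h0 h1 => ?_
    have S := hasSum_psi_combination h0 h1 5
    rw [← (theta_identities h0 h1).2.2.1] at S
    refine S.congr_fun fun n => ?_
    ring
  · refine eq_of_hasSum_pow hd fun q h0 h1 => ?_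
    have S := hasSum_psi_combination h0 h1 1
    rw [one_mul, ← (theta_identities h0 h1).2.2.2] at S
    refine S.congr_fun fun n => ?_
    ring
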